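/- For a real number $q\in(1,2)$, a $q$-expansion of a real number $x$ is a sequence $(\delta_i)_{i\ge1}\in\{0,1\}^{\mathbb{N}}$ with $x=\sum_{i=1}^\infty \delta_i q^{-i}$. Let $\mathcal{B}_{1,\aleph_0}$ be the set of all $q\in\left[\frac{1+\sqrt5}{2},2\right)$ for which the number $1$ has exactly $\aleph_0$ (that is, countably infinitely many) different $q$-expansions. Theorem. The polynomial $x^5-x^4-x^3-x+1$ has exactly one real root greater than $1$; call it $q_3$. It satisfies $|q_3-1.68042|<5\cdot10^{-6}$, and $q_3$ is the smallest element of $\mathcal{B}_{1,\aleph_0}$ strictly greater than $\frac{1+\sqrt5}{2}$. In other words, for no $q\in\left(\frac{1+\sqrt5}{2},q_3\right)$ does $1$ have exactly countably infinitely many $q$-expansions, and for $q=q_3$ it does. -/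

import Mathlib

/-- The set of `q`-expansions of `x`: the sequences `δ₁, δ₂, …` of digits in `{0, 1}` with
`x = ∑_{i ≥ 1} δᵢ / q ^ i`. The digit `δᵢ` is stored at the index `i - 1`. -/
def expansions (q x : ℝ) : Set (ℕ → Fin 2) :=
  {δ | HasSum (fun i : ℕ => ((δ i : ℕ) : ℝ) / q ^ (i + 1)) x}

/-- The set `𝓑_{1,m}` of the bases `q ∈ [(1 + √5) / 2, 2)` for which the number `1` has
exactly `m` different `q`-expansions. -/
def basesOfOne (m : Cardinal) : Set ℝ :=
  {q | q ∈ Set.Ico ((1 + Real.sqrt 5) / 2) 2 ∧ Cardinal.mk (expansions q 1) = m}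

/-! ### Expansions as bounded orbits

We rescale by `q ^ 2 - 1`: a point `x` is represented by `z = (q ^ 2 - 1) * x`, the two digit maps
become `z ↦ q * z` and `z ↦ q * z - (q ^ 2 - 1)`, and the points with an expansion are those
of `[0, q + 1]`. -/

/-! An expansion becomes an orbit under z ↦ qz and z ↦ qz − (q²−1) staying in [0, q+1]. In this
scale exchanging digits is z ↦ q+1−z, and {1, q} is the 2-cycle of (10)^∞.

Take q between the golden ratio and q₃, and put ε = q²−q−1, r = 1/q. The 2-cycle repels, so the only
points with a unique expansion are 0, q+1 and points leading to the cycle. A point with countably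
many expansions, but not a unique one, reaches a linear point by `not_countable_paths`. At each
branching there, exactly one successor has a unique expansion. The lower successor and the reflected
upper one sum to 1−ε, so one is 0 or r^l and the other is 1−ε−r^l. Following the latter to the next
branching gives an equation for q; size estimates leave only the roots of two sextics
(`Node.exceptional`).

At those roots q−1 is not a unit of ℤ[q], while every point reached from q²−1 is q²−1 times an
element of ℤ[q]. Hence q and q+1 are never reached, 0 is the only reachable point with a unique
expansion, and any nonzero point on its way to 0 passes through q²−1. Perpetual return to a
branching gives uncountably many expansions.

At q₃ the orbit is finite with one branching point: one digit leads into the 2-cycle, the other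
round a loop with digits 0001. The number of turns can be any natural number or infinity, hence ℵ₀
expansions. -/

/-- The rescaled remainders of the point `z` along the digit sequence `δ`. -/
def orbit (q z : ℝ) (δ : ℕ → Fin 2) : ℕ → ℝ
  | 0 => z
  | n + 1 => q * orbit q z δ n - ((δ n : ℕ) : ℝ) * (q ^ 2 - 1)

/-- The digit sequences whose remainders stay in `[0, q + 1]`. -/
def paths (q z : ℝ) : Set (ℕ → Fin 2) :=
  {δ | ∀ n, orbit q z δ n ∈ Set.Icc 0 (q + 1)}

theorem digit_nonneg (d : Fin 2) : (0 : ℝ) ≤ ((d : ℕ) : ℝ) := by positivity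

theorem digit_le_one (d : Fin 2) : ((d : ℕ) : ℝ) ≤ 1 := by
  have : (d : ℕ) ≤ 1 := by omega
  exact_mod_cast this

theorem sum_digits_eq {q : ℝ} (hq : 1 < q) (x : ℝ) (δ : ℕ → Fin 2) (n : ℕ) :
    ∑ i ∈ Finset.range n, ((δ i : ℕ) : ℝ) / q ^ (i + 1) =
      x - orbit q ((q ^ 2 - 1) * x) δ n / ((q ^ 2 - 1) * q ^ n) := by
  have hq0 : q ≠ 0 := by positivity
  have h1 : q ^ 2 - 1 ≠ 0 := by nlinarith
  induction n with
  | zero => simp [orbit]; field_simp; simp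
  | succ n ih =>
    rw [Finset.sum_range_succ, ih, orbit]
    field_simp
    ring

theorem expansions_eq_paths {q : ℝ} (hq : 1 < q) (x : ℝ) :
    expansions q x = paths q ((q ^ 2 - 1) * x) := by
  have hq0 : 0 < q := by positivity
  have h1 : 0 < q ^ 2 - 1 := by nlinarith
  have hnn : ∀ δ : ℕ → Fin 2, ∀ i, (0 : ℝ) ≤ ((δ i : ℕ) : ℝ) / q ^ (i + 1) := fun δ i => by
    positivity
  ext δ
  constructor
  · intro h n
    have h : HasSum (fun i : ℕ => ((δ i : ℕ) : ℝ) / q ^ (i + 1)) x := h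
    have hs := sum_digits_eq hq x δ n
    have hle := sum_le_hasSum (Finset.range n) (fun i _ => hnn δ i) h
    have htail := (hasSum_nat_add_iff' n).2 h
    -- Comparison with the tail of all ones, which is the source of the bound q + 1.
    have hgeo : HasSum (fun i : ℕ => 1 / q ^ (n + 1) * (1 / q) ^ i)
        (1 / q ^ (n + 1) * (1 - 1 / q)⁻¹) :=
      (hasSum_geometric_of_lt_one (by positivity) (by rw [div_lt_one hq0]; exact hq)).mul_left _
    have hcmp := hasSum_le (fun i => ?_) htail hgeo
    · rw [hs] at hle hcmp
      have hpos : 0 < (q ^ 2 - 1) * q ^ n := by positivity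
      have e1 : 0 ≤ orbit q ((q ^ 2 - 1) * x) δ n / ((q ^ 2 - 1) * q ^ n) := by linarith
      have e2 : orbit q ((q ^ 2 - 1) * x) δ n / ((q ^ 2 - 1) * q ^ n) ≤
          (q + 1) / ((q ^ 2 - 1) * q ^ n) := by
        have : 1 / q ^ (n + 1) * (1 - 1 / q)⁻¹ = (q + 1) / ((q ^ 2 - 1) * q ^ n) := by
          have h2 : q - 1 ≠ 0 := by linarith
          have h3 : q + 1 ≠ 0 := by linarith
          have h4 : q ^ 2 - 1 = (q - 1) * (q + 1) := by ring
          rw [h4]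
          have h5 : 1 - 1 / q = (q - 1) / q := by field_simp
          rw [h5, pow_succ]
          field_simp
        linarith
      exact ⟨by simpa using (le_div_iff₀ hpos).1 e1, (div_le_div_iff_of_pos_right hpos).1 e2⟩
    · have : 1 / q ^ (n + 1) * (1 / q) ^ i = 1 / q ^ (i + n + 1) := by
        rw [one_div_pow, one_div_mul_one_div, ← pow_add]
        congr 2
        ring
      rw [this]
      gcongr
      exact digit_le_one _
  · intro h
    change HasSum (fun i : ℕ => ((δ i : ℕ) : ℝ) / q ^ (i + 1)) x
    rw [hasSum_iff_tendsto_nat_of_nonneg (hnn δ)]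
    have hlim : Filter.Tendsto (fun n : ℕ => (q + 1) / (q ^ 2 - 1) * (1 / q) ^ n) Filter.atTop
        (nhds 0) := by
      have h1q : 1 / q < 1 := by rwa [div_lt_one hq0]
      simpa using (tendsto_pow_atTop_nhds_zero_of_lt_one (by positivity) h1q).const_mul
        ((q + 1) / (q ^ 2 - 1))
    have hz : Filter.Tendsto
        (fun n : ℕ => orbit q ((q ^ 2 - 1) * x) δ n / ((q ^ 2 - 1) * q ^ n)) Filter.atTop
        (nhds 0) := by
      refine squeeze_zero (fun n => div_nonneg (h n).1 (by positivity)) (fun n => ?_) hlim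
      have : (q + 1) / (q ^ 2 - 1) * (1 / q) ^ n = (q + 1) / ((q ^ 2 - 1) * q ^ n) := by
        rw [one_div_pow]
        field_simp
      rw [this]
      gcongr
      exact (h n).2
    have := hz.const_sub x
    simp only [sub_zero] at this
    refine this.congr fun n => (sum_digits_eq hq x δ n).symm

/-! ### Reachability and a criterion for uncountability -/

/-- One digit is read off, and the remainder still has an expansion. -/
def Step (q z w : ℝ) : Prop :=
  (w = q * z ∨ w = q * z - (q ^ 2 - 1)) ∧ w ∈ Set.Icc 0 (q + 1)

abbrev Reach (q : ℝ) : ℝ → ℝ → Prop := Relation.ReflTransGen (Step q)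

theorem orbit_congr {q z : ℝ} {δ η : ℕ → Fin 2} {n : ℕ} (h : ∀ i < n, δ i = η i) :
    orbit q z δ n = orbit q z η n := by
  induction n with
  | zero => rfl
  | succ n ih => rw [orbit, orbit, ih fun i hi => h i (by omega), h n (by omega)]

theorem orbit_add (q z : ℝ) (δ : ℕ → Fin 2) (n m : ℕ) :
    orbit q z δ (n + m) = orbit q (orbit q z δ n) (fun i => δ (n + i)) m := by
  induction m with
  | zero => rfl
  | succ m ih => rw [← add_assoc, orbit, orbit, ih]

theorem Reach.exists_orbit {q y z : ℝ} (h : Reach q y z) : ∃ δ n, orbit q y δ n = z := by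
  induction h with
  | refl => exact ⟨fun _ => 0, 0, rfl⟩
  | @tail b c _ hbc ih =>
    obtain ⟨δ, n, rfl⟩ := ih
    have key : ∀ d : Fin 2, orbit q y (fun i => if i < n then δ i else d) (n + 1) =
        q * orbit q y δ n - ((d : ℕ) : ℝ) * (q ^ 2 - 1) := fun d => by
      rw [orbit, orbit_congr (η := δ) fun i hi => if_pos hi]
      simp
    rcases hbc.1 with rfl | rfl
    · exact ⟨_, n + 1, by rw [key 0]; simp⟩
    · exact ⟨_, n + 1, by rw [key 1]; simp⟩

/-- Both digit maps move points outside [0, q+1] further out, so an orbit that leaves never returns.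
-/
theorem orbit_mem_of_succ_mem {q z : ℝ} (hq : 1 < q) {δ : ℕ → Fin 2} {n : ℕ}
    (h : orbit q z δ (n + 1) ∈ Set.Icc 0 (q + 1)) : orbit q z δ n ∈ Set.Icc 0 (q + 1) := by
  rw [orbit] at h
  obtain ⟨h1, h2⟩ := h
  have d0 := digit_nonneg (δ n)
  have d1 := digit_le_one (δ n)
  have hp : 0 < q ^ 2 - 1 := by nlinarith
  constructor
  · by_contra hc
    nlinarith [mul_nonneg d0 hp.le]
  · by_contra hc
    nlinarith [mul_le_mul_of_nonneg_right d1 hp.le]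

theorem orbit_mem_of_le {q z : ℝ} (hq : 1 < q) {δ : ℕ → Fin 2} {n m : ℕ} (hnm : n ≤ m)
    (h : orbit q z δ m ∈ Set.Icc 0 (q + 1)) : orbit q z δ n ∈ Set.Icc 0 (q + 1) := by
  induction m, hnm using Nat.le_induction with
  | base => exact h
  | succ m _ ih => exact ih (orbit_mem_of_succ_mem hq h)

/-- If every point of `N` leads to a point both of whose successors are in `N`, then the points
of `N` have uncountably many expansions. -/
theorem not_countable_paths {q : ℝ} (hq : 1 < q) {N : Set ℝ} (hI : N ⊆ Set.Icc 0 (q + 1))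
    (hN : ∀ y ∈ N, ∃ z, Reach q y z ∧ q * z ∈ N ∧ q * z - (q ^ 2 - 1) ∈ N) {y : ℝ} (hy : y ∈ N) :
    ¬ (paths q y).Countable := by
  intro hc
  obtain ⟨e, he⟩ := Set.countable_iff_exists_subset_range.1 hc
  let T := {p : (ℕ → Fin 2) × ℕ // orbit q y p.1 p.2 ∈ N}
  -- Diagonal step: a prefix ending in `N` is extended to the splitting point, and then by the digit
  -- that differs from `η`.
  have ext : ∀ (η : ℕ → Fin 2) (p : T), ∃ p' : T, p.1.2 < p'.1.2 ∧
      (∀ i < p.1.2, p'.1.1 i = p.1.1 i) ∧ ∃ i < p'.1.2, p'.1.1 i ≠ η i := by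
    rintro η ⟨⟨δ, n⟩, hp⟩
    obtain ⟨z, hz, hz0, hz1⟩ := hN _ hp
    obtain ⟨δ', m, rfl⟩ := hz.exists_orbit
    let d : Fin 2 := 1 - η (n + m)
    let ζ : ℕ → Fin 2 := fun i => if i < n then δ i else if i < n + m then δ' (i - n) else d
    have h1 : orbit q y ζ n = orbit q y δ n := orbit_congr fun i hi => if_pos hi
    have h2 : orbit q y ζ (n + m) = orbit q (orbit q y δ n) δ' m := by
      rw [orbit_add, h1]
      refine orbit_congr fun i hi => ?_
      simp [ζ, hi]
    have h3 : ζ (n + m) = d := by simp [ζ]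
    refine ⟨⟨⟨ζ, n + m + 1⟩, ?_⟩, by dsimp only; omega, fun i hi => if_pos hi, n + m, by simp, ?_⟩
    · change orbit q y ζ (n + m + 1) ∈ N
      rw [orbit, h2, h3]
      have : d = 0 ∨ d = 1 := by omega
      rcases this with h | h <;> rw [h]
      · simpa using hz0
      · simpa using hz1
    · change ζ (n + m) ≠ η (n + m)
      rw [h3]
      simp only [d]
      omega
  choose g hg1 hg2 hg3 using ext
  let s : ℕ → T := fun k => Nat.rec ⟨⟨fun _ => 0, 0⟩, hy⟩ (fun k p => g (e k) p) k
  have hs : ∀ k, s (k + 1) = g (e k) (s k) := fun k => rfl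
  have hlen : ∀ k, k ≤ (s k).1.2 := by
    intro k
    induction k with
    | zero => exact Nat.zero_le _
    | succ k ih => have := hg1 (e k) (s k); rw [hs]; omega
  have hmono : Monotone fun k => (s k).1.2 :=
    monotone_nat_of_le_succ fun k => by rw [hs]; exact (hg1 _ _).le
  have hagree : ∀ k m, k ≤ m → ∀ i < (s k).1.2, (s m).1.1 i = (s k).1.1 i := by
    intro k m hkm i hi
    induction m, hkm using Nat.le_induction with
    | base => rfl
    | succ m hm ih => rw [hs, hg2 _ _ i (hi.trans_le (hmono hm)), ih]
  let ζ : ℕ → Fin 2 := fun i => (s (i + 1)).1.1 i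
  have hζ : ∀ k, ∀ i < (s k).1.2, ζ i = (s k).1.1 i := by
    intro k i hi
    rcases le_total k (i + 1) with h | h
    · exact hagree k (i + 1) h i hi
    · exact (hagree (i + 1) k h i (hlen (i + 1))).symm
  have hmem : ζ ∈ paths q y := by
    intro n
    refine orbit_mem_of_le hq (hlen n) ?_
    rw [orbit_congr (η := (s n).1.1) (hζ n)]
    exact hI (s n).2
  obtain ⟨k, hk⟩ := he hmem
  obtain ⟨i, hi, hne⟩ := hg3 (e k) (s k)
  rw [← hs] at hi hne
  rw [← hζ (k + 1) i hi, hk] at hne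
  exact hne rfl

/-! ### Branching points and points with a unique expansion -/

/-- Both digits are allowed at `z`. -/
def Branch (q z : ℝ) : Prop := q ^ 2 - 1 ≤ q * z ∧ q * z ≤ q + 1

/-- No branching occurs at `z` or later: the expansion of `z` is unique. -/
def Single (q z : ℝ) : Prop := z ∈ Set.Icc 0 (q + 1) ∧ ∀ w, Reach q z w → ¬ Branch q w

/-- A point with several expansions, such that no point reachable from it has two successors
with several expansions. -/
def Linear (q z : ℝ) : Prop :=
  (z ∈ Set.Icc 0 (q + 1) ∧ ¬ Single q z) ∧
    ∀ w, Reach q z w → Branch q w → Single q (q * w) ∨ Single q (q * w - (q ^ 2 - 1))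

/-- The bases strictly between the golden ratio and the root of `x ^ 5 - x ^ 4 - x ^ 3 - x + 1`
that is greater than `1`. -/
structure SmallBase (q : ℝ) : Prop where
  one_lt : 1 < q
  pos : 0 < q ^ 2 - q - 1
  neg : q ^ 5 - q ^ 4 - q ^ 3 - q + 1 < 0

namespace SmallBase

variable {q : ℝ}

theorem lo (hq : SmallBase q) : 1.618 < q := by nlinarith [hq.one_lt, hq.pos]

theorem hi (hq : SmallBase q) : q < 1.6805 := by
  by_contra h
  push Not at h
  have h2 : (1.6805 : ℝ) ^ 2 ≤ q ^ 2 := by gcongr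
  have h3 : (1.6805 : ℝ) ^ 3 ≤ q ^ 3 := by gcongr
  have e : (1.6805 : ℝ) ^ 2 - q ^ 2 ≤ 0 := by linarith
  have e1 : (0.1435 : ℝ) ≤ q ^ 2 - q - 1 := by nlinarith
  nlinarith [hq.neg, mul_le_mul h3 e1 (by norm_num) (by positivity)]

end SmallBase

/-! ### Symmetry under exchange of the digits -/

theorem Step.reflect {q z w : ℝ} (h : Step q z w) : Step q (q + 1 - z) (q + 1 - w) := by
  obtain ⟨h1, h2, h3⟩ := h
  refine ⟨?_, by linarith, by linarith⟩
  rcases h1 with rfl | rfl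
  · right; ring
  · left; ring

theorem Reach.reflect {q z w : ℝ} (h : Reach q z w) : Reach q (q + 1 - z) (q + 1 - w) := by
  induction h with
  | refl => exact .refl
  | tail _ hs ih => exact ih.tail hs.reflect

theorem Branch.reflect {q z : ℝ} (h : Branch q z) : Branch q (q + 1 - z) :=
  ⟨by nlinarith [h.1, h.2], by nlinarith [h.1, h.2]⟩

theorem Single.reflect {q z : ℝ} (h : Single q z) : Single q (q + 1 - z) := by
  refine ⟨⟨by linarith [h.1.2], by linarith [h.1.1]⟩, fun w hw hb => h.2 _ ?_ hb.reflect⟩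
  simpa using hw.reflect

theorem single_reflect_iff {q z : ℝ} : Single q (q + 1 - z) ↔ Single q z :=
  ⟨fun h => by simpa using h.reflect, Single.reflect⟩

theorem Linear.reflect {q z : ℝ} (h : Linear q z) : Linear q (q + 1 - z) := by
  obtain ⟨⟨hI, hs⟩, hl⟩ := h
  refine ⟨⟨⟨by linarith [hI.2], by linarith [hI.1]⟩, by rwa [single_reflect_iff]⟩,
    fun w hw hb => ?_⟩
  have := hl _ (by simpa using hw.reflect) hb.reflect
  rw [← single_reflect_iff (z := q * w), ← single_reflect_iff (z := q * w - (q ^ 2 - 1)), or_comm]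
  convert this using 2 <;> ring

theorem Reach.mem {q z w : ℝ} (h : Reach q z w) (hz : z ∈ Set.Icc 0 (q + 1)) :
    w ∈ Set.Icc 0 (q + 1) := by
  cases h with
  | refl => exact hz
  | tail _ hs => exact hs.2

theorem Single.of_reach {q z w : ℝ} (h : Single q z) (hw : Reach q z w) : Single q w :=
  ⟨hw.mem h.1, fun v hv => h.2 v (hw.trans hv)⟩

theorem Linear.of_reach {q z w : ℝ} (h : Linear q z) (hw : Reach q z w) (hs : ¬ Single q w) :
    Linear q w :=
  ⟨⟨hw.mem h.1.1, hs⟩, fun v hv => h.2 v (hw.trans hv)⟩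

theorem Branch.step_left {q z : ℝ} (hq : 1 < q) (h : Branch q z) : Step q z (q * z) :=
  ⟨.inl rfl, by nlinarith [h.1], h.2⟩

theorem Branch.step_right {q z : ℝ} (hq : 1 < q) (h : Branch q z) :
    Step q z (q * z - (q ^ 2 - 1)) :=
  ⟨.inr rfl, by linarith [h.1], by nlinarith [h.2]⟩

theorem Branch.not_single {q z : ℝ} (h : Branch q z) : ¬ Single q z := fun hs => hs.2 z .refl h

theorem reach_pow_mul {q z : ℝ} (hq : 1 < q) (hz : 0 ≤ z) (n : ℕ) (h : q ^ n * z ≤ q + 1) :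
    Reach q z (q ^ n * z) := by
  induction n with
  | zero => simpa using Relation.ReflTransGen.refl
  | succ n ih =>
    have hp : 0 ≤ q ^ n * z := by positivity
    rw [pow_succ'] at h ⊢
    refine (ih (by nlinarith)).tail ⟨.inl (by ring), by positivity, h⟩

/-- The main elimination device: a quantity that must be a power of r is refuted by placing it
strictly between consecutive powers. -/
theorem pow_not_between {r : ℝ} (h0 : 0 < r) (h1 : r < 1) {k l : ℕ} (hlo : r ^ (k + 1) < r ^ l)
    (hhi : r ^ l < r ^ k) : False := by
  have h2 := (pow_lt_pow_iff_right_of_lt_one₀ h0 h1).1 hlo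
  have h3 := (pow_lt_pow_iff_right_of_lt_one₀ h0 h1).1 hhi
  omega

/-! ### Points with a unique expansion, and linear points -/

section SmallBase

variable {q : ℝ}

/-- Two forced digits 1, 0 send z to q + q²(z − q) and return to the same region. Iterating,
boundedness forces z = q. -/
theorem Single.eq_of_upper (hq : SmallBase q) {z : ℝ} (hs : Single q z) (h1 : q + 1 < q * z)
    (h2 : z < q ^ 2 - 1) : z = q := by
  have hlo := hq.lo
  have hhi := hq.hi
  have hpos := hq.pos
  have key : ∀ n : ℕ, ∀ z, Single q z → q + 1 < q * z → z < q ^ 2 - 1 →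
      |z - q| * (q ^ 2) ^ n ≤ 3 := by
    intro n
    induction n with
    | zero =>
      intro z _ h1 h2
      rw [pow_zero, mul_one, abs_le]
      constructor <;> nlinarith
    | succ n ih =>
      intro z hs h1 h2
      have s1 : Step q z (q * z - (q ^ 2 - 1)) :=
        ⟨.inr rfl, by nlinarith, by nlinarith [hs.1.2]⟩
      have hs1 := hs.of_reach (.single s1)
      have hb1 := hs1.2 _ .refl
      have hz1 : q * (q * z - (q ^ 2 - 1)) < q ^ 2 - 1 := by
        by_contra hc
        refine hb1 ⟨not_lt.1 hc, ?_⟩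
        have e1 : q * (q * z - (q ^ 2 - 1)) ≤ q * (q - 1) * (q ^ 2 - 1) := by nlinarith
        have e2 : q * (q - 1) * (q - 1) ≤ 1 := by nlinarith
        nlinarith
      have s2 : Step q (q * z - (q ^ 2 - 1)) (q * (q * z - (q ^ 2 - 1))) :=
        ⟨.inl rfl, mul_nonneg (by linarith) hs1.1.1, by nlinarith⟩
      have hs2 := hs1.of_reach (.single s2)
      have hb2 := hs2.2 _ .refl
      have hz2 : q + 1 < q * (q * (q * z - (q ^ 2 - 1))) := by
        by_contra hc
        refine hb2 ⟨?_, not_lt.1 hc⟩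
        have e1 : 2 + q - q ^ 2 ≤ q * z - (q ^ 2 - 1) := by linarith
        have e2 : q ^ 2 * (2 + q - q ^ 2) ≤ q ^ 2 * (q * z - (q ^ 2 - 1)) := by gcongr
        have e3 : q ^ 2 * (q ^ 2 - q - 1) ≤ 3 * 0.1436 := by
          gcongr
          · nlinarith
          · nlinarith
        nlinarith
      have := ih _ hs2 hz2 hz1
      have e : q * (q * z - (q ^ 2 - 1)) - q = (z - q) * q ^ 2 := by ring
      rw [e, abs_mul, abs_of_nonneg (sq_nonneg q)] at this
      rw [pow_succ']
      linarith
  by_contra hne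
  have hpos : 0 < |z - q| := abs_pos.2 (sub_ne_zero.2 hne)
  obtain ⟨n, hn⟩ := pow_unbounded_of_one_lt (3 / |z - q|) (show 1 < q ^ 2 by nlinarith)
  rw [div_lt_iff₀ hpos] at hn
  linarith [key n z hs h1 h2]

/-- The last multiple of u by a power of q below q² − 1 cannot branch, so it lies above the
branching window and `Single.eq_of_upper` applies. -/
theorem Single.exists_pow_mul_eq (hq : SmallBase q) {u : ℝ} (hs : Single q u) (h0 : 0 < u)
    (h1 : q * u < q ^ 2 - 1) : ∃ n, q ^ (n + 1) * u = q ∧ Reach q u q := by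
  have hlo := hq.lo
  have hex : ∃ n : ℕ, q ^ 2 - 1 ≤ q ^ n * u := by
    obtain ⟨n, hn⟩ := pow_unbounded_of_one_lt ((q ^ 2 - 1) / u) hq.one_lt
    rw [div_lt_iff₀ h0] at hn
    exact ⟨n, hn.le⟩
  classical
  obtain ⟨n, hn⟩ : ∃ n, Nat.find hex = n + 2 := by
    have h2 : Nat.find hex ≠ 0 := fun h => by
      have := Nat.find_spec hex
      rw [h, pow_zero, one_mul] at this
      nlinarith
    have h3 : Nat.find hex ≠ 1 := fun h => by
      have := Nat.find_spec hex
      rw [h, pow_one] at this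
      linarith
    exact ⟨Nat.find hex - 2, by omega⟩
  have hge := Nat.find_spec hex
  have hlt := Nat.find_min hex (m := n + 1) (by omega)
  rw [hn] at hge
  push Not at hlt
  have hr := reach_pow_mul hq.one_lt h0.le (n + 1) (by nlinarith [hq.hi])
  have hs' := hs.of_reach hr
  have hz : q ^ (n + 1) * u = q := by
    refine hs'.eq_of_upper hq ?_ hlt
    by_contra hc
    refine hs'.2 _ .refl ⟨?_, not_lt.1 hc⟩
    rw [← mul_assoc, ← pow_succ']
    exact hge
  exact ⟨n, hz, by rwa [hz] at hr⟩

/-- The bound 2 + q − q² is the largest possible value of a lower successor at a branching, and of a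
reflected upper one. -/
theorem Single.eq_zero_or_pow (hq : SmallBase q) {u : ℝ} (hs : Single q u)
    (h1 : u ≤ 2 + q - q ^ 2) : u = 0 ∨ ∃ l, 1 ≤ l ∧ u = q⁻¹ ^ l := by
  have hlo := hq.lo
  have hpos := hq.pos
  rcases hs.1.1.eq_or_lt with h | h0
  · exact .inl h.symm
  obtain ⟨n, hn, -⟩ := hs.exists_pow_mul_eq hq h0 (by nlinarith)
  have hn' : q ^ n * u = 1 := by
    rw [pow_succ'] at hn
    nlinarith
  refine .inr ⟨n, ?_, ?_⟩
  · rcases Nat.eq_zero_or_pos n with rfl | h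
    · rw [pow_zero] at hn'; linarith
    · exact h
  · rw [inv_pow]
    exact eq_inv_of_mul_eq_one_right hn'

theorem Single.eq_or_reach (hq : SmallBase q) {z : ℝ} (hs : Single q z) :
    z = 0 ∨ z = q + 1 ∨ Reach q z q := by
  have hlo := hq.lo
  have hhi := hq.hi
  rcases lt_or_ge (q * z) (q ^ 2 - 1) with h | h
  · rcases hs.1.1.eq_or_lt with h0 | h0
    · exact .inl h0.symm
    · exact .inr (.inr (hs.exists_pow_mul_eq hq h0 h).choose_spec.2)
  · have h2 : q + 1 < q * z := by
      by_contra hc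
      exact hs.2 z .refl ⟨h, not_lt.1 hc⟩
    rcases hs.1.2.eq_or_lt with h0 | h0
    · exact .inr (.inl h0)
    · right; right
      have := (hs.reflect.exists_pow_mul_eq hq (by linarith) (by nlinarith)).choose_spec.2.reflect
      rw [sub_sub_cancel, add_sub_cancel_left] at this
      exact this.tail ⟨.inl (by ring), by linarith, by linarith⟩

/-- The lower successor and the reflected upper one sum to 1 − ε. Each would be 0 or a power r^l
with l ≥ 1, but r + r² exceeds 1 − ε while r, r + r³ and 2r² fall short. -/
theorem Branch.not_single_and_single (hq : SmallBase q) {z : ℝ} (hb : Branch q z)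
    (h1 : Single q (q * z)) (h2 : Single q (q * z - (q ^ 2 - 1))) : False := by
  have hlo := hq.lo
  have hhi := hq.hi
  have hpos := hq.pos
  set r := q⁻¹ with hr
  have hqr : q * r = 1 := mul_inv_cancel₀ (by linarith)
  have r0 : 0 < r := by positivity
  have rlo : 0.595 < r := by nlinarith
  have rhi : r < 0.6181 := by nlinarith
  have r1 : r < 1 := by linarith
  have hε : q ^ 2 - q - 1 < 0.1436 := by nlinarith
  have hrr : r + r ^ 2 = 1 - (q ^ 2 - q - 1) * r ^ 2 := by
    linear_combination (q * r + 1 - r) * hqr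
  have hle : ∀ k l : ℕ, k ≤ l → r ^ l ≤ r ^ k := fun k l h => pow_le_pow_of_le_one r0.le r1.le h
  have hc : ∀ l, 1 ≤ l → 2 + q - q ^ 2 ≠ r ^ l := by
    intro l hl h
    have := hle 1 l hl
    rw [pow_one] at this
    linarith
  have hsum : ∀ k m, 1 ≤ k → k ≤ m → 2 + q - q ^ 2 ≠ r ^ k + r ^ m := by
    intro k m hk hkm h
    rcases hk.eq_or_lt with rfl | hk
    · rw [pow_one] at h
      have : m = 1 ∨ m = 2 ∨ 3 ≤ m := by omega
      rcases this with rfl | rfl | hm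
      · rw [pow_one] at h; linarith
      · nlinarith
      · have := hle 3 m hm
        nlinarith
    · have e1 := hle 2 k hk
      have e2 := hle 2 m (by omega)
      nlinarith
  have hu := h2.eq_zero_or_pow hq (by linarith [hb.2])
  have hv := h1.reflect.eq_zero_or_pow hq (by linarith [hb.1])
  rcases hu with hu | ⟨k, hk, hu⟩ <;> rcases hv with hv | ⟨m, hm, hv⟩
  · linarith
  · exact hc m hm (by linarith)
  · exact hc k hk (by linarith)
  · rcases le_total k m with h | h
    · exact hsum k m hk h (by linarith)
    · exact hsum m k hm h (by linarith)

/-- The continuation of a linear point at a branching: one successor has a unique expansion and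
determines the other one. -/
theorem Linear.exists_next (hq : SmallBase q) {z : ℝ} (hl : Linear q z) (hb : Branch q z) :
    ∃ b, (b = 0 ∨ ∃ l, 1 ≤ l ∧ b = q⁻¹ ^ l) ∧ Linear q (2 + q - q ^ 2 - b) ∧
      (b = q * z - (q ^ 2 - 1) ∨ b = q + 1 - q * z) := by
  rcases hl.2 z .refl hb with h | h
  · refine ⟨q + 1 - q * z, h.reflect.eq_zero_or_pow hq (by linarith [hb.1]), ?_, .inr rfl⟩
    have := hl.of_reach (.single (hb.step_right hq.one_lt)) fun h' => hb.not_single_and_single hq h h'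
    convert this using 1
    ring
  · refine ⟨q * z - (q ^ 2 - 1), h.eq_zero_or_pow hq (by linarith [hb.2]), ?_, .inl rfl⟩
    have := hl.of_reach (.single (hb.step_left hq.one_lt)) fun h' => hb.not_single_and_single hq h' h
    convert this.reflect using 1
    ring

theorem exists_reach_single (hq : 1 < q) {z : ℝ} (hz : z ∈ Set.Icc 0 (q + 1))
    (hc : (paths q z).Countable) : ∃ w, Reach q z w ∧ Single q w := by
  by_contra! h
  refine not_countable_paths hq (N := {w | Reach q z w}) (fun w hw => Reach.mem hw hz)
    (fun y hy => ?_) (y := z) .refl hc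
  have hy : Reach q z y := hy
  have := h y hy
  rw [Single] at this
  push Not at this
  obtain ⟨w, hw, hb⟩ := this (hy.mem hz)
  exact ⟨w, hw, (hy.trans hw).tail (hb.step_left hq), (hy.trans hw).tail (hb.step_right hq)⟩

/-- Otherwise every reachable point with several expansions leads to a branching whose successors
both have several, and the uncountability criterion applies. -/
theorem exists_reach_linear (hq : 1 < q) {z : ℝ} (hz : z ∈ Set.Icc 0 (q + 1)) (hs : ¬ Single q z)
    (hc : (paths q z).Countable) : ∃ w, Reach q z w ∧ Linear q w := by
  by_contra! h
  refine not_countable_paths hq (N := {w | Reach q z w ∧ ¬ Single q w})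
    (fun w hw => Reach.mem hw.1 hz) (fun y hy => ?_) (y := z) ⟨.refl, hs⟩ hc
  obtain ⟨hy, hys⟩ : Reach q z y ∧ ¬ Single q y := hy
  have := h y hy
  rw [Linear] at this
  push Not at this
  obtain ⟨w, hw, hb, h1, h2⟩ := this ⟨hy.mem hz, hys⟩
  exact ⟨w, hw, ⟨(hy.trans hw).tail (hb.step_left hq), h1⟩,
    (hy.trans hw).tail (hb.step_right hq), h2⟩

theorem exists_linear_of_countable (hq : SmallBase q) {z : ℝ} (hz : z ∈ Set.Icc 0 (q + 1))
    (hs : ¬ Single q z) (hc : (paths q z).Countable) :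
    ∃ b, (b = 0 ∨ ∃ l, 1 ≤ l ∧ b = q⁻¹ ^ l) ∧ Linear q (2 + q - q ^ 2 - b) := by
  obtain ⟨w, -, hl⟩ := exists_reach_linear hq.one_lt hz hs hc
  have hns := hl.1.2
  rw [Single] at hns
  push Not at hns
  obtain ⟨v, hv, hb⟩ := hns hl.1.1
  obtain ⟨b, h1, h2, -⟩ := (hl.of_reach hv hb.not_single).exists_next hq hb
  exact ⟨b, h1, h2⟩

end SmallBase

/-! ### The bases for which a linear point can exist -/

section Elimination

variable {q : ℝ}

/-- The last bound is the quintic inequality divided by q. -/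
theorem SmallBase.exists_inv (hq : SmallBase q) : ∃ r, q⁻¹ = r ∧ q * r = 1 ∧ 0.595 < r ∧
    r < 0.61804 ∧ r + r ^ 2 = 1 - (q ^ 2 - q - 1) * r ^ 2 ∧
    q ^ 2 * (q ^ 2 - q - 1) < 1 - r := by
  have hlo := hq.lo
  have hhi := hq.hi
  have hpos := hq.pos
  have hqr : q * q⁻¹ = 1 := mul_inv_cancel₀ (by linarith)
  have r0 : 0 < q⁻¹ := by positivity
  refine ⟨q⁻¹, rfl, hqr, by nlinarith, ?_, ?_, ?_⟩
  · have : 1.618033 < q := by nlinarith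
    nlinarith
  · linear_combination (q * q⁻¹ + 1 - q⁻¹) * hqr
  · have := mul_neg_of_pos_of_neg r0 hq.neg
    have e : q⁻¹ * (q ^ 5 - q ^ 4 - q ^ 3 - q + 1) = q ^ 2 * (q ^ 2 - q - 1) - (1 - q⁻¹) := by
      linear_combination (q ^ 4 - q ^ 3 - q ^ 2 - 1) * hqr
    linarith

/-- The powers of a base in the range under consideration, up to small errors. -/
theorem SmallBase.pow_bounds (hq : SmallBase q) : q ^ 2 - q - 1 < 0.1436 ∧
    (2.6178 < q ^ 2 ∧ q ^ 2 < 2.8241) ∧ (4.2357 < q ^ 3 ∧ q ^ 3 < 4.746) ∧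
    (6.853 < q ^ 4 ∧ q ^ 4 < 7.976) := by
  have hlo := hq.lo
  have hhi := hq.hi
  have h2 : 2.6178 < q ^ 2 ∧ q ^ 2 < 2.8241 := by constructor <;> nlinarith
  have h3 : 4.2355 < q ^ 3 ∧ q ^ 3 < 4.746 := by constructor <;> nlinarith
  have hg : 4.2357 < q ^ 3 := by nlinarith [hq.pos]
  have h4 : 6.853 < q ^ 4 ∧ q ^ 4 < 7.976 := by constructor <;> nlinarith
  exact ⟨by nlinarith, h2, ⟨hg, h3.2⟩, h4⟩

theorem inv_pow_bounds {r : ℝ} (h0 : 0.595 < r) (h1 : r < 0.61804) :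
    (0.354 < r ^ 2 ∧ r ^ 2 < 0.38198) ∧ (0.2106 < r ^ 3 ∧ r ^ 3 < 0.23608) ∧
    (0.125 < r ^ 4 ∧ r ^ 4 < 0.14591) ∧ (0.0744 < r ^ 5 ∧ r ^ 5 < 0.09018) := by
  have h2 : 0.354 < r ^ 2 ∧ r ^ 2 < 0.38198 := by constructor <;> nlinarith
  have h3 : 0.2106 < r ^ 3 ∧ r ^ 3 < 0.23608 := by constructor <;> nlinarith
  have h4 : 0.1253 < r ^ 4 ∧ r ^ 4 < 0.14591 := by constructor <;> nlinarith
  have h5 : 0.0744 < r ^ 5 ∧ r ^ 5 < 0.09018 := by constructor <;> nlinarith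
  exact ⟨h2, h3, ⟨by linarith [h4.1], h4.2⟩, h5⟩

/-! ### Transitions from one branching to the next -/

/-- The point `2 + q - q ^ 2 - q ^ (-l)` is linear. -/
def Node (q : ℝ) (l : ℕ) : Prop := Linear q (2 + q - q ^ 2 - q⁻¹ ^ l)

/-- After n digits 0 a branching occurs. Strictness of the bounds excludes the successors 0 and q +
1, so the next point is again a node. -/
theorem Linear.exists_next_of_pow_mul (hq : SmallBase q) {x : ℝ} (hl : Linear q x) (hx : 0 ≤ x)
    (n : ℕ) (h1 : q ^ 2 - 1 < q ^ (n + 1) * x) (h2 : q ^ (n + 1) * x < q + 1) :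
    ∃ l, 1 ≤ l ∧ Node q l ∧
      (q⁻¹ ^ l = q ^ (n + 1) * x - (q ^ 2 - 1) ∨ q⁻¹ ^ l = q + 1 - q ^ (n + 1) * x) := by
  have hlo := hq.lo
  have e : q ^ (n + 1) * x = q * (q ^ n * x) := by ring
  rw [e] at h1 h2
  have hr := reach_pow_mul hq.one_lt hx n (by nlinarith)
  have hb : Branch q (q ^ n * x) := ⟨h1.le, h2.le⟩
  obtain ⟨b, hb0, hlin, hbe⟩ := (hl.of_reach hr hb.not_single).exists_next hq hb
  rcases hb0 with rfl | ⟨l, hl1, rfl⟩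
  · rcases hbe with h | h <;> linarith
  · exact ⟨l, hl1, hlin, by rwa [e]⟩

theorem Linear.next_zero (hq : SmallBase q) (h : Linear q (2 + q - q ^ 2)) :
    ∃ l, 1 ≤ l ∧ Node q l ∧ q⁻¹ ^ l = (q ^ 2 - q - 1) * (q ^ 2 - 1) := by
  obtain ⟨r, hr, hqr, rlo, rhi, hrr, hK⟩ := hq.exists_inv
  obtain ⟨he, ⟨q2l, q2u⟩, -⟩ := hq.pow_bounds
  have hpos := hq.pos
  have hA : 0 < (q ^ 2 - q - 1) * (q ^ 2 - 1) := mul_pos hpos (by linarith)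
  have e : q ^ (1 + 1) * (2 + q - q ^ 2) = q ^ 2 - q ^ 2 * (q ^ 2 - q - 1) := by ring
  obtain ⟨l, hl, hn, h⟩ := h.exists_next_of_pow_mul hq (by linarith) 1
    (by rw [e]; linarith) (by rw [e]; linarith)
  refine ⟨l, hl, hn, ?_⟩
  rcases h with h | h
  · exfalso
    have e : q⁻¹ ^ l = 1 - q ^ 2 * (q ^ 2 - q - 1) := by rw [h]; ring
    rw [hr] at e
    refine pow_not_between (r := r) (k := 0) (l := l) (by linarith) (by linarith) ?_ ?_
    · rw [e, zero_add, pow_one]; linarith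
    · rw [e, pow_zero]; nlinarith
  · rw [h]; ring

/-- The point 1 − ε − r^l branches after one digit 0 if l ≥ 3, but after two if l = 2 and three if l
= 1; hence three transition rules. The alternatives record which successor has the unique expansion.
-/
theorem Node.next_add_three (hq : SmallBase q) {k : ℕ} (h : Node q (k + 3)) :
    ∃ l, 1 ≤ l ∧ Node q l ∧ (q⁻¹ ^ l = q⁻¹ ^ (k + 1) + (q ^ 2 - q - 1) * (q ^ 2 - 1) ∨
      q⁻¹ ^ l = 1 - q ^ 2 * (q ^ 2 - q - 1) - q⁻¹ ^ (k + 1)) := by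
  obtain ⟨r, hr, hqr, rlo, rhi, hrr, hK⟩ := hq.exists_inv
  obtain ⟨he, ⟨q2l, q2u⟩, -⟩ := hq.pow_bounds
  have hpos := hq.pos
  have r0 : 0 < r := by linarith
  have hle : r ^ (k + 1) ≤ r ^ 1 := pow_le_pow_of_le_one r0.le (by linarith) (by omega)
  have hp : 0 < r ^ (k + 1) := by positivity
  have e : q ^ (1 + 1) * (2 + q - q ^ 2 - r ^ (k + 3)) = q ^ 2 * (2 + q - q ^ 2) - r ^ (k + 1) := by
    have : r ^ (k + 3) = r ^ (k + 1) * r ^ 2 := by ring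
    rw [this]
    linear_combination (-r ^ (k + 1) * (q * r + 1)) * hqr
  have h0 : r ^ (k + 3) ≤ r ^ (k + 1) := pow_le_pow_of_le_one r0.le (by linarith) (by omega)
  have hA : 0 < (q ^ 2 - q - 1) * (q ^ 2 - 1) := mul_pos hpos (by linarith)
  rw [Node, hr] at h
  obtain ⟨l, hl, hn, h⟩ := h.exists_next_of_pow_mul hq (by linarith) 1
    (by rw [e]; linarith) (by rw [e]; linarith)
  rw [e] at h
  refine ⟨l, hl, hn, ?_⟩
  rw [hr] at h ⊢
  rcases h with h | h
  · right; rw [h]; ring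
  · left; rw [h]; ring

theorem Node.next_two (hq : SmallBase q) (h : Node q 2) :
    ∃ l, 1 ≤ l ∧ Node q l ∧ (q⁻¹ ^ l = (q ^ 2 - q - 1) * (q ^ 3 - q - 1) ∨
      q⁻¹ ^ l = 1 - (q ^ 2 - q - 1) * (q ^ 3 - q)) := by
  obtain ⟨r, hr, hqr, rlo, rhi, hrr, hK⟩ := hq.exists_inv
  obtain ⟨he, ⟨q2l, q2u⟩, ⟨q3l, q3u⟩, -⟩ := hq.pow_bounds
  obtain ⟨⟨r2l, r2u⟩, -⟩ := inv_pow_bounds rlo rhi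
  have hpos := hq.pos
  have hlo := hq.lo
  have hhi := hq.hi
  have e : q ^ (2 + 1) * (2 + q - q ^ 2 - r ^ 2) = q ^ 3 * (2 + q - q ^ 2) - q := by
    linear_combination (-q * (q * r + 1)) * hqr
  have hC : 0 < (q ^ 2 - q - 1) * (q ^ 3 - q - 1) := mul_pos hpos (by linarith)
  have hD : (q ^ 2 - q - 1) * (q ^ 3 - q) < 0.1436 * 5 :=
    mul_lt_mul'' he (by linarith) hpos.le (by linarith)
  rw [Node, hr] at h
  obtain ⟨l, hl, hn, h⟩ := h.exists_next_of_pow_mul hq (by linarith) 2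
    (by rw [e]; linarith) (by rw [e]; linarith)
  rw [e] at h
  refine ⟨l, hl, hn, ?_⟩
  rcases h with h | h
  · right; rw [h]; ring
  · left; rw [h]; ring

theorem Node.next_one (hq : SmallBase q) (h : Node q 1) :
    ∃ l, 1 ≤ l ∧ Node q l ∧ (q⁻¹ ^ l = (q ^ 2 - q - 1) * (q ^ 4 - q ^ 2 - 1) ∨
      q⁻¹ ^ l = 1 - (q ^ 2 - q - 1) * (q ^ 4 - q ^ 2)) := by
  obtain ⟨r, hr, hqr, rlo, rhi, hrr, hK⟩ := hq.exists_inv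
  obtain ⟨he, ⟨q2l, q2u⟩, ⟨q3l, q3u⟩, ⟨q4l, q4u⟩⟩ := hq.pow_bounds
  have hpos := hq.pos
  have hlo := hq.lo
  have hhi := hq.hi
  have e : q ^ (3 + 1) * (2 + q - q ^ 2 - r ^ 1) = q ^ 4 * (2 + q - q ^ 2) - q ^ 3 := by
    linear_combination (-q ^ 3) * hqr
  have hC : 0 < (q ^ 2 - q - 1) * (q ^ 4 - q ^ 2 - 1) := mul_pos hpos (by linarith)
  have hD : (q ^ 2 - q - 1) * (q ^ 4 - q ^ 2) < 0.1436 * 6 :=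
    mul_lt_mul'' he (by linarith) hpos.le (by linarith)
  rw [Node, hr] at h
  obtain ⟨l, hl, hn, h⟩ := h.exists_next_of_pow_mul hq (by rw [pow_one]; linarith) 3
    (by rw [e]; linarith) (by rw [e]; linarith)
  rw [e] at h
  refine ⟨l, hl, hn, ?_⟩
  rcases h with h | h
  · right; rw [h]; ring
  · left; rw [h]; ring

/-- The base has one of two algebraic values. -/
def Exceptional (q : ℝ) : Prop :=
  q ^ 6 - q ^ 4 - q ^ 3 - 2 * q ^ 2 - q - 1 = 0 ∨ q ^ 6 - 2 * q ^ 4 - q ^ 3 - 1 = 0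

/-! ### Elimination of transitions -/

theorem Node.false_of_two (hq : SmallBase q) (h : Node q 2) (hε : q ^ 2 - q - 1 = q⁻¹ ^ 4) :
    False := by
  obtain ⟨l, hl, -, h⟩ := h.next_two hq
  obtain ⟨r, hr, hqr, rlo, rhi, hrr, hK⟩ := hq.exists_inv
  obtain ⟨he, ⟨q2l, q2u⟩, ⟨q3l, q3u⟩, ⟨q4l, q4u⟩⟩ := hq.pow_bounds
  obtain ⟨⟨r2l, r2u⟩, ⟨r3l, r3u⟩, ⟨r4l, r4u⟩, -⟩ := inv_pow_bounds rlo rhi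
  rw [hr] at h hε
  have r0 : 0 < r := by linarith
  have hq1 : 1.67 < q := by nlinarith [hq.lo]
  have hr1 : r < 0.599 := by nlinarith
  rcases h with h | h
  · have e : r ^ l = r ^ 3 * (q ^ 2 - 1 - r) := by
      rw [h, hε]
      linear_combination (r ^ 3 * (q ^ 2 - 1)) * hqr
    refine pow_not_between (k := 2) (l := l) r0 (by linarith) ?_ ?_
    · rw [e]
      exact lt_mul_of_one_lt_right (by positivity) (by linarith)
    · rw [e, pow_succ r 2, mul_assoc]
      refine mul_lt_of_lt_one_right (by positivity) ?_
      have : r * (q ^ 2 - 1 - r) < 0.599 * 1.5 := by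
        refine mul_lt_mul'' hr1 (by linarith) r0.le (by linarith)
      linarith
  · have e : r ^ l = 1 - r + r ^ 3 := by
      rw [h, hε]
      linear_combination (-r + r ^ 3 - q * r ^ 2 - q ^ 2 * r ^ 3) * hqr
    refine pow_not_between (k := 0) (l := l) r0 (by linarith) ?_ ?_
    · rw [e, zero_add, pow_one]
      linarith
    · rw [e, pow_zero]
      linarith

/-- The quintic inequality q³ε < q − 1 bounds the right side below by 1 − r − ε, which exceeds r³.
-/
theorem SmallBase.cube_lt (hq : SmallBase q) :
    q⁻¹ ^ 3 < 1 - (q ^ 2 - q - 1) * (q ^ 4 - q ^ 2) := by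
  obtain ⟨r, hr, hqr, rlo, rhi, hrr, hK⟩ := hq.exists_inv
  obtain ⟨he, -⟩ := hq.pow_bounds
  obtain ⟨-, ⟨r3l, r3u⟩, -⟩ := inv_pow_bounds rlo rhi
  have hlo := hq.lo
  rw [hr]
  have e1 : (q ^ 2 - q - 1) * (q ^ 4 - q ^ 2) = q ^ 3 * (q ^ 2 - q - 1) * (q - r) := by
    linear_combination ((q ^ 2 - q - 1) * q ^ 2) * hqr
  have e2 : q ^ 3 * (q ^ 2 - q - 1) * (q - r) < (q - 1) * (q - r) :=
    mul_lt_mul_of_pos_right (by linarith [hq.neg]) (by linarith)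
  have e3 : (q - 1) * (q - r) = r + (q ^ 2 - q - 1) := by linear_combination (-1) * hqr
  linarith

theorem SmallBase.inv_pow_eq (hq : SmallBase q) (k : ℕ) :
    q⁻¹ ^ (k + 1) = q ^ 2 * q⁻¹ ^ (k + 3) ∧ q⁻¹ ^ k = q * q⁻¹ ^ (k + 1) := by
  have hlo := hq.lo
  have h0 : q ≠ 0 := by linarith
  constructor <;> simp only [inv_pow] <;> field_simp <;> ring

/-- The quintic inequality, used twice, puts the right side strictly below r. Equality holds at the
root of the quintic: it is the loop found there. -/
theorem SmallBase.inv_ne (hq : SmallBase q) :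
    q⁻¹ ≠ (q ^ 2 - q - 1) * (q ^ 4 - q ^ 2 - 1) := by
  obtain ⟨r, hr, hqr, rlo, rhi, hrr, hK⟩ := hq.exists_inv
  obtain ⟨he, ⟨q2l, q2u⟩, ⟨q3l, q3u⟩, ⟨q4l, q4u⟩⟩ := hq.pow_bounds
  obtain ⟨⟨r2l, r2u⟩, ⟨r3l, r3u⟩, ⟨r4l, r4u⟩, ⟨r5l, r5u⟩⟩ := inv_pow_bounds rlo rhi
  have hpos := hq.pos
  have hlo := hq.lo
  have r0 : 0 < r := by linarith
  have r1 : r < 1 := by linarith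
  rw [hr]
  intro h
  have hqe : q ^ 3 * (q ^ 2 - q - 1) < q - 1 := by linarith [hq.neg]
  have e1 : (q ^ 2 - q - 1) * (q ^ 4 - q ^ 2 - 1) =
      q ^ 3 * (q ^ 2 - q - 1) * (q - r - r ^ 3) := by
    linear_combination ((q ^ 2 - q - 1) * (q ^ 2 + 1 + q * r + q ^ 2 * r ^ 2)) * hqr
  have e2 : q ^ 3 * (q ^ 2 - q - 1) * (q - r - r ^ 3) < (q - 1) * (q - r - r ^ 3) :=
    mul_lt_mul_of_pos_right hqe (by linarith)
  have e3 : (q - 1) * (q - r - r ^ 3) = r + (q ^ 2 - q - 1) - r ^ 3 * (q - 1) := by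
    linear_combination (-1) * hqr
  have e4 : q ^ 2 - q - 1 < r ^ 3 * (q - 1) := by
    have := mul_lt_mul_of_pos_left hqe (show 0 < r ^ 3 by positivity)
    have e : r ^ 3 * (q ^ 3 * (q ^ 2 - q - 1)) = q ^ 2 - q - 1 := by
      linear_combination ((q ^ 2 - q - 1) * (1 + q * r + q ^ 2 * r ^ 2)) * hqr
    linarith
  linarith

/-- Here and in the next two lemmas, the equation is refuted by one further transition, whose
possible values lie strictly between consecutive powers of r. -/
theorem Node.ne_of_two (hq : SmallBase q) (hn : Node q 2) :
    q⁻¹ ^ 2 ≠ (q ^ 2 - q - 1) * (q ^ 4 - q ^ 2 - 1) := by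
  obtain ⟨m, -, -, h'⟩ := hn.next_two hq
  obtain ⟨r, hr, hqr, rlo, rhi, hrr, hK⟩ := hq.exists_inv
  obtain ⟨he, ⟨q2l, q2u⟩, ⟨q3l, q3u⟩, ⟨q4l, q4u⟩⟩ := hq.pow_bounds
  obtain ⟨⟨r2l, r2u⟩, ⟨r3l, r3u⟩, ⟨r4l, r4u⟩, ⟨r5l, r5u⟩⟩ := inv_pow_bounds rlo rhi
  have hpos := hq.pos
  have hlo := hq.lo
  have r0 : 0 < r := by linarith
  have r1 : r < 1 := by linarith
  rw [hr] at h' ⊢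
  intro h
  have h3 : r ^ 3 = (q ^ 2 - q - 1) * (q ^ 3 - q - r) := by
    linear_combination r * h + ((q ^ 2 - q - 1) * (q ^ 3 - q)) * hqr
  rcases h' with h' | h'
  · have h4 : r ^ 4 = (q ^ 2 - q - 1) * (q ^ 2 - 1 - r ^ 2) := by
      linear_combination r * h3 + ((q ^ 2 - q - 1) * (q ^ 2 - 1)) * hqr
    have hqε : 0 < q * (q ^ 2 - q - 1) := mul_pos (by linarith) hpos
    refine pow_not_between (k := 3) (l := m) r0 r1 ?_ ?_
    · rw [h', h4]
      exact mul_lt_mul_of_pos_left (by linarith) hpos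
    · rw [h', h3]
      exact mul_lt_mul_of_pos_left (by linarith) hpos
  · have hεr : (q ^ 2 - q - 1) * r < 0.1436 * 0.61804 := mul_lt_mul'' he rhi hpos.le r0.le
    refine pow_not_between (k := 0) (l := m) r0 r1 ?_ ?_
    · rw [h', zero_add, pow_one]
      linarith
    · rw [h', pow_zero]
      have : 0 < (q ^ 2 - q - 1) * (q ^ 3 - q) := mul_pos hpos (by linarith [hq.hi])
      linarith

theorem Node.ne_of_four (hq : SmallBase q) (hn : Node q 4) :
    q⁻¹ ^ 4 ≠ (q ^ 2 - q - 1) * (q ^ 4 - q ^ 2 - 1) := by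
  obtain ⟨m, -, -, h'⟩ := Node.next_add_three hq (k := 1) hn
  obtain ⟨r, hr, hqr, rlo, rhi, hrr, hK⟩ := hq.exists_inv
  obtain ⟨he, ⟨q2l, q2u⟩, ⟨q3l, q3u⟩, ⟨q4l, q4u⟩⟩ := hq.pow_bounds
  obtain ⟨⟨r2l, r2u⟩, ⟨r3l, r3u⟩, ⟨r4l, r4u⟩, ⟨r5l, r5u⟩⟩ := inv_pow_bounds rlo rhi
  have hpos := hq.pos
  have hlo := hq.lo
  have r0 : 0 < r := by linarith
  have r1 : r < 1 := by linarith
  rw [hr, show 1 + 1 = 2 from rfl] at h'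
  rw [hr]
  intro h
  have hE : (q ^ 2 - q - 1) * 3 < r ^ 4 := by
    rw [h]
    exact mul_lt_mul_of_pos_left (by linarith) hpos
  have hε : q ^ 2 - q - 1 < 0.049 := by linarith
  rcases h' with h' | h'
  · have : (q ^ 2 - q - 1) * (q ^ 2 - 1) < 0.049 * 2 :=
      mul_lt_mul'' hε (by linarith) hpos.le (by linarith)
    have hp : 0 < (q ^ 2 - q - 1) * (q ^ 2 - 1) := mul_pos hpos (by linarith)
    refine pow_not_between (k := 1) (l := m) r0 r1 ?_ ?_
    · rw [show 1 + 1 = 2 from rfl]; linarith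
    · rw [pow_one]; linarith
  · have : q ^ 2 * (q ^ 2 - q - 1) < 3 * 0.049 :=
      mul_lt_mul'' (by linarith) hε (by linarith) hpos.le
    have h2 : (q ^ 2 - q - 1) * r ^ 2 < (q ^ 2 - q - 1) * q ^ 2 :=
      mul_lt_mul_of_pos_left (by linarith) hpos
    refine pow_not_between (k := 1) (l := m) r0 r1 ?_ ?_
    · rw [show 1 + 1 = 2 from rfl]; linarith
    · rw [pow_one]; linarith

theorem Node.ne_of_five_le (hq : SmallBase q) {k : ℕ} (hk : 2 ≤ k) (hn : Node q (k + 3)) :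
    q⁻¹ ^ (k + 3) ≠ (q ^ 2 - q - 1) * (q ^ 4 - q ^ 2 - 1) := by
  obtain ⟨m, -, -, h'⟩ := hn.next_add_three hq
  obtain ⟨hk1, hk0⟩ := hq.inv_pow_eq k
  obtain ⟨r, hr, hqr, rlo, rhi, hrr, hK⟩ := hq.exists_inv
  obtain ⟨he, ⟨q2l, q2u⟩, ⟨q3l, q3u⟩, ⟨q4l, q4u⟩⟩ := hq.pow_bounds
  obtain ⟨⟨r2l, r2u⟩, ⟨r3l, r3u⟩, ⟨r4l, r4u⟩, ⟨r5l, r5u⟩⟩ := inv_pow_bounds rlo rhi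
  have hpos := hq.pos
  have hlo := hq.lo
  have r0 : 0 < r := by linarith
  have r1 : r < 1 := by linarith
  have hle : ∀ k l : ℕ, k ≤ l → r ^ l ≤ r ^ k := fun k l h => pow_le_pow_of_le_one r0.le r1.le h
  rw [hr] at h' hk1 hk0 ⊢
  intro h
  rcases h' with h' | h'
  · refine pow_not_between (k := k) (l := m) r0 r1 ?_ ?_
    · have hp : 0 < (q ^ 2 - q - 1) * (q ^ 2 - 1) := mul_pos hpos (by linarith)
      linarith
    · rw [h', hk0]
      have e1 : (q - 1) * r ^ (k + 1) =
          (q ^ 2 - q - 1) * ((q - 1) * (q ^ 2 * (q ^ 4 - q ^ 2 - 1))) := by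
        rw [hk1, h]; ring
      have e2 : (q ^ 2 - q - 1) * ((q - 1) * (q + 1)) <
          (q ^ 2 - q - 1) * ((q - 1) * (q ^ 2 * (q ^ 4 - q ^ 2 - 1))) := by
        refine mul_lt_mul_of_pos_left (mul_lt_mul_of_pos_left ?_ (by linarith)) hpos
        have : (2 : ℝ) * 3 < q ^ 2 * (q ^ 4 - q ^ 2 - 1) :=
          mul_lt_mul'' (by linarith) (by linarith) (by norm_num) (by norm_num)
        linarith [hq.hi]
      linarith
  · have hE : (q ^ 2 - q - 1) * 3 < r ^ (k + 3) := by
      rw [h]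
      exact mul_lt_mul_of_pos_left (by linarith) hpos
    have h5 := hle 5 (k + 3) (by omega)
    have h3 := hle 3 (k + 1) (by omega)
    have hε : q ^ 2 - q - 1 < 0.0301 := by linarith
    have : q ^ 2 * (q ^ 2 - q - 1) < 3 * 0.0301 :=
      mul_lt_mul'' (by linarith) hε (by linarith) hpos.le
    have h0 : 0 < q ^ 2 * (q ^ 2 - q - 1) := by positivity
    refine pow_not_between (k := 0) (l := m) r0 r1 ?_ ?_
    · rw [zero_add, pow_one]; linarith
    · have : 0 < r ^ (k + 1) := by positivity
      rw [pow_zero]; linarith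

theorem Node.exceptional_one (hq : SmallBase q) (h : Node q 1) : Exceptional q := by
  obtain ⟨l, hl, hn, h⟩ := h.next_one hq
  have hF := hq.cube_lt
  have hlo := hq.lo
  rcases h with h | h
  · obtain rfl | rfl | rfl | rfl | hl5 : l = 1 ∨ l = 2 ∨ l = 3 ∨ l = 4 ∨ 5 ≤ l := by omega
    · rw [pow_one] at h
      exact absurd h hq.inv_ne
    · exact absurd h (hn.ne_of_two hq)
    -- The transition from index 1 to 3 gives the first sextic; below, the one from 1 to 1 gives the
    -- second.
    · left
      obtain ⟨r, hr, hqr, -⟩ := hq.exists_inv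
      rw [hr] at h
      have : (q - 1) ^ 2 * (q + 1) * (q ^ 6 - q ^ 4 - q ^ 3 - 2 * q ^ 2 - q - 1) = 0 := by
        linear_combination (-q ^ 3) * h + (1 + q * r + q ^ 2 * r ^ 2) * hqr
      have hne : (q - 1) ^ 2 * (q + 1) ≠ 0 := by
        have : 0 < q - 1 := by linarith
        positivity
      exact (mul_eq_zero.1 this).resolve_left hne
    · exact absurd h (hn.ne_of_four hq)
    · obtain ⟨k, rfl⟩ : ∃ k, l = k + 3 := ⟨l - 3, by omega⟩
      exact absurd h (hn.ne_of_five_le hq (by omega))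
  · obtain ⟨r, hr, hqr, rlo, rhi, -⟩ := hq.exists_inv
    have r2 : r ^ 2 < 1 := (inv_pow_bounds rlo rhi).1.2.trans (by norm_num)
    rw [hr] at h hF
    obtain rfl | rfl | hl3 : l = 1 ∨ l = 2 ∨ 3 ≤ l := by omega
    · right
      have : (q - 1) * (q ^ 6 - 2 * q ^ 4 - q ^ 3 - 1) = 0 := by
        linear_combination q * h - hqr
      exact (mul_eq_zero.1 this).resolve_left (by linarith)
    · exfalso
      refine hn.false_of_two hq ?_
      rw [hr]
      have : (1 - r ^ 2) * (q ^ 2 - q - 1 - r ^ 4) = 0 := by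
        linear_combination r ^ 4 * h + (q ^ 2 - q - 1) *
          (r ^ 2 * (q * r + 1) - (q ^ 3 * r ^ 3 + q ^ 2 * r ^ 2 + q * r + 1)) * hqr
      linarith [(mul_eq_zero.1 this).resolve_left (by linarith)]
    · exfalso
      linarith [pow_le_pow_of_le_one (by linarith) (by linarith) hl3 (a := r)]

/-- As q²ε < 1 − r, the right side exceeds r − r³, which exceeds r². -/
theorem SmallBase.eq_one_of_pow_eq (hq : SmallBase q) {k m : ℕ} (hk : 2 ≤ k) (hm : 1 ≤ m)
    (h : q⁻¹ ^ m = 1 - q ^ 2 * (q ^ 2 - q - 1) - q⁻¹ ^ (k + 1)) : m = 1 := by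
  obtain ⟨r, hr, hqr, rlo, rhi, hrr, hK⟩ := hq.exists_inv
  have hpos := hq.pos
  have r0 : 0 < r := by linarith
  have r1 : r < 1 := by linarith
  have hle : ∀ k l : ℕ, k ≤ l → r ^ l ≤ r ^ k := fun k l h => pow_le_pow_of_le_one r0.le r1.le h
  rw [hr] at h
  by_contra hne
  have h2 := hle 2 m (by omega)
  have h3 := hle 3 (k + 1) (by omega)
  have : r * (r + r ^ 2) < r * 1 := by
    refine mul_lt_mul_of_pos_left ?_ r0
    nlinarith [mul_pos hpos (pow_pos r0 2)]
  linarith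

theorem Node.ne_of_three (hq : SmallBase q) (hn : Node q 3) :
    q⁻¹ ^ 3 ≠ (q ^ 2 - q - 1) * (q ^ 3 - q - 1) := by
  obtain ⟨m, hm, -, h'⟩ := Node.next_add_three hq (k := 0) hn
  obtain ⟨r, hr, hqr, rlo, rhi, hrr, hK⟩ := hq.exists_inv
  obtain ⟨he, ⟨q2l, q2u⟩, ⟨q3l, q3u⟩, ⟨q4l, q4u⟩⟩ := hq.pow_bounds
  obtain ⟨⟨r2l, r2u⟩, ⟨r3l, r3u⟩, ⟨r4l, r4u⟩, ⟨r5l, r5u⟩⟩ := inv_pow_bounds rlo rhi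
  have hpos := hq.pos
  have hlo := hq.lo
  have r0 : 0 < r := by linarith
  have r1 : r < 1 := by linarith
  have hle : ∀ k l : ℕ, k ≤ l → r ^ l ≤ r ^ k := fun k l h => pow_le_pow_of_le_one r0.le r1.le h
  rw [hr, zero_add, pow_one] at h'
  rw [hr]
  intro h
  rcases h' with h' | h'
  · have := hle 1 m hm
    have hA : 0 < (q ^ 2 - q - 1) * (q ^ 2 - 1) := mul_pos hpos (by linarith)
    rw [pow_one] at this
    linarith
  · have hmono : ∀ x y : ℝ, 1 < x → x ≤ y → x ^ 2 - x - 1 ≤ y ^ 2 - y - 1 := fun x y hx hxy => by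
      have := mul_nonneg (sub_nonneg.2 hxy) (show 0 ≤ x + y - 1 by linarith)
      linarith
    have hmono' : ∀ x y : ℝ, 1 < x → x ≤ y → x ^ 3 - x - 1 ≤ y ^ 3 - y - 1 := fun x y hx hxy => by
      have h2 : x ^ 2 ≤ y ^ 2 := by gcongr
      have : x * (x ^ 2 - 1) ≤ y * (y ^ 2 - 1) :=
        mul_le_mul hxy (by linarith) (by linarith [one_lt_pow₀ hx two_ne_zero]) (by linarith)
      linarith
    -- In the equation r³ decreases with q and the other side increases, so comparison near q = 5/3
    -- pins q. The next value then lies between r⁵ and r⁴.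
    have hq1 : 1.665 < q := by
      by_contra hc
      push Not at hc
      have r3 : 0.6 < r := by linarith [mul_le_mul_of_nonneg_right hc r0.le]
      have e1 : (0.6 : ℝ) ^ 3 < r ^ 3 := by gcongr
      have e2 := hmono _ _ (by linarith) hc
      have e3 := hmono' _ _ (by linarith) hc
      have e4 := mul_le_mul e2 e3 (by linarith) (by norm_num)
      norm_num at e1 e4
      linarith
    have hq2 : q < 1.668 := by
      by_contra hc
      push Not at hc
      have r3 : r < 0.6 := by linarith [mul_le_mul_of_nonneg_right hc r0.le]
      have e1 : r ^ 3 < (0.6 : ℝ) ^ 3 := by gcongr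
      have e2 := hmono _ _ (by norm_num) hc
      have e3 := hmono' _ _ (by norm_num) hc
      have e4 := mul_le_mul e2 e3 (by norm_num) (by linarith)
      norm_num at e1 e4
      linarith
    have hr1 : r < 0.60061 := by linarith [mul_lt_mul_of_pos_right hq1 r0]
    have hr2 : 0.5995 < r := by linarith [mul_lt_mul_of_pos_right hq2 r0]
    have e1 : (0.5995 : ℝ) ^ 4 < r ^ 4 := by gcongr
    have e2 : r ^ 5 < (0.60061 : ℝ) ^ 5 := by gcongr
    have e3 : (1.665 : ℝ) ^ 2 * (1.665 ^ 2 - 1.665 - 1) ≤ q ^ 2 * (q ^ 2 - q - 1) :=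
      mul_le_mul (by gcongr) (hmono _ _ (by norm_num) hq1.le) (by norm_num) (by positivity)
    have e4 : q ^ 2 * (q ^ 2 - q - 1) ≤ (1.668 : ℝ) ^ 2 * (1.668 ^ 2 - 1.668 - 1) :=
      mul_le_mul (by gcongr) (hmono _ _ (by linarith) hq2.le) hpos.le (by norm_num)
    norm_num at e1 e2 e3 e4
    exact pow_not_between (k := 4) (l := m) r0 r1 (by rw [show 4 + 1 = 5 from rfl]; linarith)
      (by linarith)

theorem Node.exceptional_of_four (hq : SmallBase q) (hn : Node q 4)
    (h : q⁻¹ ^ 4 = (q ^ 2 - q - 1) * (q ^ 3 - q - 1)) : Exceptional q := by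
  obtain ⟨m, hm, hn', h'⟩ := Node.next_add_three hq (k := 1) hn
  obtain ⟨r, hr, hqr, rlo, rhi, hrr, hK⟩ := hq.exists_inv
  obtain ⟨he, ⟨q2l, q2u⟩, ⟨q3l, q3u⟩, ⟨q4l, q4u⟩⟩ := hq.pow_bounds
  obtain ⟨⟨r2l, r2u⟩, ⟨r3l, r3u⟩, ⟨r4l, r4u⟩, ⟨r5l, r5u⟩⟩ := inv_pow_bounds rlo rhi
  have hpos := hq.pos
  have hlo := hq.lo
  have r0 : 0 < r := by linarith
  have r1 : r < 1 := by linarith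
  have hle : ∀ k l : ℕ, k ≤ l → r ^ l ≤ r ^ k := fun k l h => pow_le_pow_of_le_one r0.le r1.le h
  rw [hr, show 1 + 1 = 2 from rfl] at h'
  rw [hr] at h
  obtain rfl | hm2 : m = 1 ∨ 2 ≤ m := by omega
  · exact hn'.exceptional_one hq
  exfalso
  have h2 := hle 2 m hm2
  rcases h' with h' | h'
  · have hA : 0 < (q ^ 2 - q - 1) * (q ^ 2 - 1) := mul_pos hpos (by linarith)
    linarith
  · have hqε : 0 < (q + 1) * (q ^ 2 - q - 1) := mul_pos (by linarith) hpos
    have her : 0 < (q ^ 2 - q - 1) * r ^ 2 := by positivity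
    have e1 : q ^ 2 * (q ^ 2 - q - 1) * (q ^ 3 - q - 1) = r ^ 2 := by
      linear_combination (-q ^ 2) * h + r ^ 2 * (q * r + 1) * hqr
    have e2 : q ^ 2 * (q ^ 2 - q - 1) * q < q ^ 2 * (q ^ 2 - q - 1) * (q ^ 3 - q - 1) :=
      mul_lt_mul_of_pos_left (by linarith) (by positivity)
    have e3 : q ^ 2 * (q ^ 2 - q - 1) < r ^ 3 := by
      have := mul_lt_mul_of_pos_left (e2.trans_eq e1) r0
      have e : r * (q ^ 2 * (q ^ 2 - q - 1) * q) = q ^ 2 * (q ^ 2 - q - 1) := by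
        linear_combination (q ^ 2 * (q ^ 2 - q - 1)) * hqr
      linarith [pow_succ' r 2]
    have e4 : r * (r + r ^ 2) < r * 1 := mul_lt_mul_of_pos_left (by linarith) r0
    have e5 : r * (r + r ^ 2) = r ^ 2 + r ^ 3 := by ring
    linarith

theorem Node.exceptional_of_ge_five (hq : SmallBase q) {k : ℕ} (hk : 2 ≤ k) (hn : Node q (k + 3))
    (h : q⁻¹ ^ (k + 3) = (q ^ 2 - q - 1) * (q ^ 3 - q - 1)) : Exceptional q := by
  obtain ⟨m, hm, hn', h'⟩ := hn.next_add_three hq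
  rcases h' with h' | h'
  · exfalso
    obtain ⟨hk1, hk0⟩ := hq.inv_pow_eq k
    obtain ⟨r, hr, hqr, rlo, rhi, hrr, hK⟩ := hq.exists_inv
    obtain ⟨he, ⟨q2l, q2u⟩, ⟨q3l, q3u⟩, ⟨q4l, q4u⟩⟩ := hq.pow_bounds
    obtain ⟨⟨r2l, r2u⟩, ⟨r3l, r3u⟩, ⟨r4l, r4u⟩, ⟨r5l, r5u⟩⟩ := inv_pow_bounds rlo rhi
    have hpos := hq.pos
    have hlo := hq.lo
    have r0 : 0 < r := by linarith
    have r1 : r < 1 := by linarith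
    have hhi := hq.hi
    rw [hr] at h h' hk1 hk0
    have hA : 0 < (q ^ 2 - q - 1) * (q ^ 2 - 1) := mul_pos hpos (by linarith)
    refine pow_not_between (k := k) (l := m) r0 r1 (by linarith) ?_
    rw [h', hk0]
    have e1 : (q - 1) * r ^ (k + 1) =
        (q ^ 2 - q - 1) * ((q - 1) * (q ^ 2 * (q ^ 3 - q - 1))) := by
      rw [hk1, h]; ring
    have e2 : (q ^ 2 - q - 1) * ((q - 1) * (q + 1)) <
        (q ^ 2 - q - 1) * ((q - 1) * (q ^ 2 * (q ^ 3 - q - 1))) := by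
      refine mul_lt_mul_of_pos_left (mul_lt_mul_of_pos_left ?_ (by linarith)) hpos
      have : (2.6 : ℝ) * 1.5 < q ^ 2 * (q ^ 3 - q - 1) :=
        mul_lt_mul'' (by linarith) (by linarith) (by norm_num) (by norm_num)
      linarith
    linarith
  · obtain rfl := hq.eq_one_of_pow_eq hk hm h'
    exact hn'.exceptional_one hq

theorem Node.exceptional_two (hq : SmallBase q) (h : Node q 2) : Exceptional q := by
  obtain ⟨l, hl, hn, h⟩ := h.next_two hq
  rcases h with h | h
  · obtain hl2 | rfl | rfl | hl5 : l ≤ 2 ∨ l = 3 ∨ l = 4 ∨ 5 ≤ l := by omega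
    · exfalso
      obtain ⟨r, hr, hqr, rlo, rhi, hrr, hK⟩ := hq.exists_inv
      obtain ⟨he, ⟨q2l, q2u⟩, ⟨q3l, q3u⟩, ⟨q4l, q4u⟩⟩ := hq.pow_bounds
      obtain ⟨⟨r2l, r2u⟩, ⟨r3l, r3u⟩, ⟨r4l, r4u⟩, ⟨r5l, r5u⟩⟩ := inv_pow_bounds rlo rhi
      have hpos := hq.pos
      have hlo := hq.lo
      have r0 : 0 < r := by linarith
      have r1 : r < 1 := by linarith
      have hle : ∀ k l : ℕ, k ≤ l → r ^ l ≤ r ^ k := fun k l h => pow_le_pow_of_le_one r0.le r1.le h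
      have hC : (q ^ 2 - q - 1) * (q ^ 3 - q - 1) < 0.1436 * 2.13 :=
        mul_lt_mul'' he (by linarith) hpos.le (by linarith [hq.hi])
      rw [hr] at h
      linarith [hle l 2 hl2]
    · exact absurd h (hn.ne_of_three hq)
    · exact hn.exceptional_of_four hq h
    · obtain ⟨k, rfl⟩ : ∃ k, l = k + 3 := ⟨l - 3, by omega⟩
      exact hn.exceptional_of_ge_five hq (by omega) h
  · obtain rfl | hl2 : l = 1 ∨ 2 ≤ l := by omega
    · exact hn.exceptional_one hq
    · exfalso
      obtain ⟨r, hr, hqr, rlo, rhi, hrr, hK⟩ := hq.exists_inv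
      obtain ⟨he, ⟨q2l, q2u⟩, ⟨q3l, q3u⟩, ⟨q4l, q4u⟩⟩ := hq.pow_bounds
      obtain ⟨⟨r2l, r2u⟩, ⟨r3l, r3u⟩, ⟨r4l, r4u⟩, ⟨r5l, r5u⟩⟩ := inv_pow_bounds rlo rhi
      have hpos := hq.pos
      have hlo := hq.lo
      have r0 : 0 < r := by linarith
      have r1 : r < 1 := by linarith
      have hle : ∀ k l : ℕ, k ≤ l → r ^ l ≤ r ^ k := fun k l h => pow_le_pow_of_le_one r0.le r1.le h
      have hD : (q ^ 2 - q - 1) * (q ^ 3 - q) < 0.1436 * 3.13 :=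
        mul_lt_mul'' he (by linarith) hpos.le (by linarith [hq.hi])
      rw [hr] at h
      linarith [hle 2 l hl2]

theorem Node.exceptional_four (hq : SmallBase q) (h : Node q 4) : Exceptional q := by
  obtain ⟨m, hm, hn, h⟩ := Node.next_add_three hq (k := 1) h
  obtain ⟨r, hr, hqr, rlo, rhi, hrr, hK⟩ := hq.exists_inv
  obtain ⟨he, ⟨q2l, q2u⟩, -⟩ := hq.pow_bounds
  have hpos := hq.pos
  have r0 : 0 < r := by linarith
  have r1 : r < 1 := by linarith
  have hle : ∀ k l : ℕ, k ≤ l → r ^ l ≤ r ^ k := fun k l h => pow_le_pow_of_le_one r0.le r1.le h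
  have hA : 0 < (q ^ 2 - q - 1) * (q ^ 2 - 1) := mul_pos hpos (by linarith)
  have her : 0 < (q ^ 2 - q - 1) * r ^ 2 := by positivity
  rw [hr, show 1 + 1 = 2 from rfl] at h
  obtain rfl | rfl | hm3 : m = 1 ∨ m = 2 ∨ 3 ≤ m := by omega
  · exact hn.exceptional_one hq
  · exact hn.exceptional_two hq
  exfalso
  have h3 := hle 3 m hm3
  have h2 := hle 2 m (by omega)
  have e4 : r * (r + r ^ 2) < r * 1 := mul_lt_mul_of_pos_left (by linarith) r0
  have e5 : r * (r + r ^ 2) = r ^ 2 + r ^ 3 := by ring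
  have h23 : r ^ 3 < r ^ 2 := pow_lt_pow_right_of_lt_one₀ r0 r1 (by norm_num)
  rcases h with h | h <;> linarith

theorem Node.exceptional_three (hq : SmallBase q) (h : Node q 3) : Exceptional q := by
  obtain ⟨m, hm, hn, h⟩ := Node.next_add_three hq (k := 0) h
  have hF := hq.cube_lt
  obtain ⟨r, hr, hqr, rlo, rhi, hrr, hK⟩ := hq.exists_inv
  obtain ⟨he, ⟨q2l, q2u⟩, -⟩ := hq.pow_bounds
  have hpos := hq.pos
  have hlo := hq.lo
  have r0 : 0 < r := by linarith
  have r1 : r < 1 := by linarith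
  have hle : ∀ k l : ℕ, k ≤ l → r ^ l ≤ r ^ k := fun k l h => pow_le_pow_of_le_one r0.le r1.le h
  have hA : 0 < (q ^ 2 - q - 1) * (q ^ 2 - 1) := mul_pos hpos (by linarith)
  rw [hr] at hF
  rw [zero_add, hr, pow_one] at h
  rcases h with h | h
  · have := hle 1 m hm
    rw [pow_one] at this
    linarith
  obtain hm2 | rfl | rfl | hm5 : m ≤ 2 ∨ m = 3 ∨ m = 4 ∨ 5 ≤ m := by omega
  · exfalso
    have := hle m 2 hm2
    nlinarith
  -- The transition from index 3 to itself gives the first sextic again.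
  · left
    have : (q - 1) * (q ^ 6 - q ^ 4 - q ^ 3 - 2 * q ^ 2 - q - 1) = 0 := by
      linear_combination q ^ 3 * h - (1 + q * r + q ^ 2 * r ^ 2 + q ^ 2) * hqr
    exact (mul_eq_zero.1 this).resolve_left (by linarith)
  · exact hn.exceptional_four hq
  · obtain ⟨k, rfl⟩ : ∃ k, m = k + 3 := ⟨m - 3, by omega⟩
    obtain ⟨n, hn1, hn', h'⟩ := hn.next_add_three hq
    rcases h' with h' | h'
    · obtain rfl | rfl | hn3 : n = 1 ∨ n = 2 ∨ 3 ≤ n := by omega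
      · exact hn'.exceptional_one hq
      · exact hn'.exceptional_two hq
      · exfalso
        rw [hr] at h'
        have hk : r ^ (k + 1) = q ^ 2 * r ^ (k + 3) := by
          have : r ^ (k + 3) = r ^ (k + 1) * r ^ 2 := by ring
          rw [this]
          linear_combination (-r ^ (k + 1) * (q * r + 1)) * hqr
        have e : r ^ n = 1 - (q ^ 2 - q - 1) * (q ^ 4 - q ^ 2) := by
          rw [h', hk, h]
          linear_combination (-q) * hqr
        linarith [hle 3 n hn3]
    · obtain rfl := hq.eq_one_of_pow_eq (by omega) hn1 h'
      exact hn'.exceptional_one hq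

theorem Node.exceptional_of_five_le (hq : SmallBase q) {l : ℕ} (hl : 5 ≤ l) (h : Node q l) :
    Exceptional q := by
  obtain ⟨k, rfl⟩ : ∃ k, l = k + 3 := ⟨l - 3, by omega⟩
  obtain ⟨m, hm, hn, h⟩ := h.next_add_three hq
  rcases h with h | h
  · obtain rfl | rfl | rfl | rfl | hm5 : m = 1 ∨ m = 2 ∨ m = 3 ∨ m = 4 ∨ 5 ≤ m := by omega
    · exact hn.exceptional_one hq
    · exact hn.exceptional_two hq
    · exact hn.exceptional_three hq
    · exact hn.exceptional_four hq
    · obtain ⟨j, rfl⟩ : ∃ j, m = j + 3 := ⟨m - 3, by omega⟩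
      obtain ⟨n, hn1, hn', h'⟩ := hn.next_add_three hq
      rcases h' with h' | h'
      -- Two additive transitions in a row: by the first the summand ε(q² − 1) is below r^(j+3), so
      -- the second value lies between r^(j+1) and r^j.
      · exfalso
        obtain ⟨r, hr, hqr, rlo, rhi, hrr, hK⟩ := hq.exists_inv
        obtain ⟨he, ⟨q2l, q2u⟩, -⟩ := hq.pow_bounds
        obtain ⟨-, ⟨r3l, r3u⟩, -⟩ := inv_pow_bounds rlo rhi
        have r0 : 0 < r := by linarith
        have hA : 0 < (q ^ 2 - q - 1) * (q ^ 2 - 1) := mul_pos hq.pos (by linarith)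
        rw [hr] at h h'
        refine pow_not_between (k := j) (l := n) r0 (by linarith) (by linarith) ?_
        have e1 : r ^ j * (r + r ^ 3) < r ^ j * 1 :=
          mul_lt_mul_of_pos_left (by linarith) (by positivity)
        have e2 : r ^ j * (r + r ^ 3) = r ^ (j + 1) + r ^ (j + 3) := by ring
        have e3 : 0 < r ^ (k + 1) := by positivity
        linarith
      · obtain rfl := hq.eq_one_of_pow_eq (by omega) hn1 h'
        exact hn'.exceptional_one hq
  · obtain rfl := hq.eq_one_of_pow_eq (by omega) hm h
    exact hn.exceptional_one hq

theorem Node.exceptional (hq : SmallBase q) {l : ℕ} (hl : 1 ≤ l) (h : Node q l) :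
    Exceptional q := by
  obtain rfl | rfl | rfl | rfl | hl5 : l = 1 ∨ l = 2 ∨ l = 3 ∨ l = 4 ∨ 5 ≤ l := by omega
  · exact h.exceptional_one hq
  · exact h.exceptional_two hq
  · exact h.exceptional_three hq
  · exact h.exceptional_four hq
  · exact h.exceptional_of_five_le hq hl5

theorem SmallBase.exceptional_of_countable (hq : SmallBase q) {z : ℝ}
    (hz : z ∈ Set.Icc 0 (q + 1)) (hs : ¬ Single q z) (hc : (paths q z).Countable) :
    Exceptional q := by
  obtain ⟨b, rfl | ⟨l, hl, rfl⟩, h⟩ := exists_linear_of_countable hq hz hs hc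
  · rw [sub_zero] at h
    obtain ⟨l, hl, hn, -⟩ := h.next_zero hq
    exact hn.exceptional hq hl
  · exact Node.exceptional hq hl h

end Elimination

/-! ### Prefixing a digit -/

/-- The digit sequence `δ` preceded by the digit `d`. -/
def consDigit (d : Fin 2) (δ : ℕ → Fin 2) : ℕ → Fin 2
  | 0 => d
  | n + 1 => δ n

theorem consDigit_injective (d : Fin 2) : Function.Injective (consDigit d) := fun δ η h => by
  funext n
  exact congrFun h (n + 1)

theorem orbit_consDigit (q z : ℝ) (d : Fin 2) (δ : ℕ → Fin 2) (n : ℕ) :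
    orbit q z (consDigit d δ) (n + 1) = orbit q (q * z - ((d : ℕ) : ℝ) * (q ^ 2 - 1)) δ n := by
  induction n with
  | zero => rfl
  | succ n ih => rw [orbit, ih]; rfl

theorem consDigit_mem_paths {q z : ℝ} (hq : 1 < q) {d : Fin 2} {δ : ℕ → Fin 2}
    (h : δ ∈ paths q (q * z - ((d : ℕ) : ℝ) * (q ^ 2 - 1))) : consDigit d δ ∈ paths q z := by
  have hsucc : ∀ n, orbit q z (consDigit d δ) (n + 1) ∈ Set.Icc 0 (q + 1) := fun n => by
    rw [orbit_consDigit]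
    exact h n
  intro n
  cases n with
  | zero => exact orbit_mem_of_succ_mem hq (hsucc 0)
  | succ n => exact hsucc n

theorem Step.exists_injective {q z w : ℝ} (hq : 1 < q) (h : Step q z w) :
    ∃ d, Set.MapsTo (consDigit d) (paths q w) (paths q z) := by
  rcases h.1 with rfl | rfl
  · exact ⟨0, fun δ hδ => consDigit_mem_paths hq (by simpa using hδ)⟩
  · exact ⟨1, fun δ hδ => consDigit_mem_paths hq (by simpa using hδ)⟩

theorem Reach.countable_paths {q z w : ℝ} (hq : 1 < q) (h : Reach q z w)
    (hz : (paths q z).Countable) : (paths q w).Countable := by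
  induction h with
  | refl => exact hz
  | tail _ hs ih =>
    obtain ⟨d, hd⟩ := hs.exists_injective hq
    exact hd.countable_of_injOn (consDigit_injective d).injOn ih

theorem Reach.finite_paths {q z w : ℝ} (hq : 1 < q) (h : Reach q z w)
    (hz : (paths q z).Finite) : (paths q w).Finite := by
  induction h with
  | refl => exact hz
  | tail _ hs ih =>
    obtain ⟨d, hd⟩ := hs.exists_injective hq
    exact Set.Finite.of_injOn hd (consDigit_injective d).injOn ih

/-! ### The exceptional bases -/

section Exceptional

open Polynomial

/-- Reduction mod 2: the hypotheses exclude factorizations of degrees 3+3, 4+2 and 5+1 by comparing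
coefficients, a finite check. -/
theorem irreducible_of_coeff_zmod_two {f : ℤ[X]} (hf : f.Monic) (hd : f.natDegree = 6)
    (h : ∀ a b c d e g : ZMod 2,
      (c * g, b * g + c * e, a * g + b * e + c * d, g + a * e + b * d + c, e + a * d + b, d + a) ≠
        ((f.coeff 0 : ZMod 2), (f.coeff 1 : ZMod 2), (f.coeff 2 : ZMod 2), (f.coeff 3 : ZMod 2),
          (f.coeff 4 : ZMod 2), (f.coeff 5 : ZMod 2)))
    (h' : ∀ a b c d e g : ZMod 2,
      (d * g, c * g + d * e, b * g + c * e + d, a * g + b * e + c, g + a * e + b, e + a) ≠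
        ((f.coeff 0 : ZMod 2), (f.coeff 1 : ZMod 2), (f.coeff 2 : ZMod 2), (f.coeff 3 : ZMod 2),
          (f.coeff 4 : ZMod 2), (f.coeff 5 : ZMod 2)))
    (h'' : ∀ a b c d e g : ZMod 2,
      (e * g, d * g + e, c * g + d, b * g + c, a * g + b, g + a) ≠
        ((f.coeff 0 : ZMod 2), (f.coeff 1 : ZMod 2), (f.coeff 2 : ZMod 2), (f.coeff 3 : ZMod 2),
          (f.coeff 4 : ZMod 2), (f.coeff 5 : ZMod 2))) :
    Irreducible f := by
  refine hf.irreducible_of_irreducible_map (Int.castRingHom (ZMod 2)) f ?_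
  have hm := hf.map (Int.castRingHom (ZMod 2))
  have hdm : (f.map (Int.castRingHom (ZMod 2))).natDegree = 6 := by
    rw [hf.natDegree_map, hd]
  rw [hm.irreducible_iff_natDegree']
  refine ⟨fun h1 => ?_, fun u v hu hv huv hmem => ?_⟩
  · rw [h1, natDegree_one] at hdm
    omega
  rw [hdm, Finset.mem_Ioc] at hmem
  have hdeg : u.natDegree + v.natDegree = 6 := by rw [← hu.natDegree_mul hv, huv, hdm]
  have hc : ∀ n, (u * v).coeff n = (f.coeff n : ZMod 2) := fun n => by rw [huv, coeff_map]; simp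
  have hu0 : ∀ n, u.natDegree < n → u.coeff n = 0 := fun n => coeff_eq_zero_of_natDegree_lt
  have hv0 : ∀ n, v.natDegree < n → v.coeff n = 0 := fun n => coeff_eq_zero_of_natDegree_lt
  have hu1 := hu.coeff_natDegree
  have hv1 := hv.coeff_natDegree
  simp only [coeff_mul, Finset.Nat.sum_antidiagonal_eq_sum_range_succ_mk] at hc
  have hcases : v.natDegree = 3 ∨ v.natDegree = 2 ∨ v.natDegree = 1 := by omega
  rcases hcases with hv' | hv' | hv'
  · have hu' : u.natDegree = 3 := by omega
    rw [hu'] at hu0 hu1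
    rw [hv'] at hv0 hv1
    refine h (u.coeff 2) (u.coeff 1) (u.coeff 0) (v.coeff 2) (v.coeff 1) (v.coeff 0) ?_
    simp only [← hc, Finset.sum_range_succ, Finset.sum_range_zero]
    simp [hu0, hv0, hu1, hv1]
    refine ⟨?_, ?_, ?_, ?_, ?_⟩ <;> ring
  · have hu' : u.natDegree = 4 := by omega
    rw [hu'] at hu0 hu1
    rw [hv'] at hv0 hv1
    refine h' (u.coeff 3) (u.coeff 2) (u.coeff 1) (u.coeff 0) (v.coeff 1) (v.coeff 0) ?_
    simp only [← hc, Finset.sum_range_succ, Finset.sum_range_zero]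
    simp [hu0, hv0, hu1, hv1]
    refine ⟨?_, ?_, ?_, ?_, ?_⟩ <;> ring
  · have hu' : u.natDegree = 5 := by omega
    rw [hu'] at hu0 hu1
    rw [hv'] at hv0 hv1
    refine h'' (u.coeff 4) (u.coeff 3) (u.coeff 2) (u.coeff 1) (u.coeff 0) (v.coeff 0) ?_
    simp only [← hc, Finset.sum_range_succ, Finset.sum_range_zero]
    simp [hv0, hu1, hv1]
    refine ⟨?_, ?_, ?_, ?_, ?_⟩ <;> ring

/-- Equality would make f, the minimal polynomial of x, divide (X − 1)p − X; at X = 1 this says that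
f(1) divides −1. For the two sextics f(1) is −5 and −3. -/
theorem sub_one_mul_aeval_ne {f : ℤ[X]} (hf : f.Monic) (hirr : Irreducible f)
    (h1 : ¬ IsUnit (f.eval 1)) {x : ℝ} (hx : aeval x f = 0) (p : ℤ[X]) :
    (x - 1) * aeval x p ≠ x := by
  intro h
  have hint : IsIntegral ℤ x := ⟨f, hf, by simpa [aeval_def] using hx⟩
  have hg : aeval x ((X - 1) * p - X) = 0 := by simp [h]
  have d1 := minpoly.isIntegrallyClosed_dvd hint hx
  have d2 := minpoly.isIntegrallyClosed_dvd hint hg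
  have hass : Associated (minpoly ℤ x) f :=
    (minpoly.prime_of_isIntegrallyClosed hint).irreducible.associated_of_dvd hirr d1
  have d3 := eval_dvd (x := 1) (hass.symm.dvd.trans d2)
  simp at d3
  exact h1 (isUnit_of_dvd_one (by simpa using d3))

theorem irreducible_fst :
    Irreducible (X ^ 6 - X ^ 4 - X ^ 3 - 2 * X ^ 2 - X - 1 : ℤ[X]) := by
  have hd : (X ^ 6 - X ^ 4 - X ^ 3 - 2 * X ^ 2 - X - 1 : ℤ[X]).natDegree = 6 := by compute_degree!
  have hm : (X ^ 6 - X ^ 4 - X ^ 3 - 2 * X ^ 2 - X - 1 : ℤ[X]).Monic := by monicity!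
  refine irreducible_of_coeff_zmod_two hm hd ?_ ?_ ?_ <;>
  · simp [coeff_X, coeff_one, coeff_X_pow, coeff_ofNat_mul]
    decide

theorem irreducible_snd : Irreducible (X ^ 6 - 2 * X ^ 4 - X ^ 3 - 1 : ℤ[X]) := by
  have hd : (X ^ 6 - 2 * X ^ 4 - X ^ 3 - 1 : ℤ[X]).natDegree = 6 := by compute_degree!
  have hm : (X ^ 6 - 2 * X ^ 4 - X ^ 3 - 1 : ℤ[X]).Monic := by monicity!
  refine irreducible_of_coeff_zmod_two hm hd ?_ ?_ ?_ <;>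
  · simp [coeff_one, coeff_X_pow, coeff_ofNat_mul]
    decide

theorem Exceptional.sub_one_mul_aeval_ne {q : ℝ} (h : Exceptional q) (p : ℤ[X]) :
    (q - 1) * aeval q p ≠ q := by
  have h2 : aeval q (2 : ℤ[X]) = 2 := map_ofNat _ 2
  rcases h with h | h
  · refine _root_.sub_one_mul_aeval_ne (by monicity!) irreducible_fst ?_ (by simpa [h2] using h) p
    simp [Int.isUnit_iff]
  · refine _root_.sub_one_mul_aeval_ne (by monicity!) irreducible_snd ?_ (by simpa [h2] using h) p
    simp [Int.isUnit_iff]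

theorem Reach.exists_aeval {q z : ℝ} (h : Reach q (q ^ 2 - 1) z) :
    ∃ p : ℤ[X], z = (q ^ 2 - 1) * aeval q p := by
  induction h with
  | refl => exact ⟨1, by simp⟩
  | tail _ hs ih =>
    obtain ⟨p, rfl⟩ := ih
    rcases hs.1 with rfl | rfl
    · exact ⟨X * p, by simp; ring⟩
    · exact ⟨X * p - 1, by simp; ring⟩

/-- From a nonzero point, 0 is entered only from (q² − 1)/q by the digit 1, and the digit 0 there
gives q² − 1. -/
theorem Reach.eq_zero_or_reach {q z : ℝ} (hq : SmallBase q) (h : Reach q z 0) :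
    z = 0 ∨ Reach q z (q ^ 2 - 1) := by
  have hlo := hq.lo
  have hhi := hq.hi
  induction h using Relation.ReflTransGen.head_induction_on with
  | refl => exact .inl rfl
  | @head a c hac _ ih =>
    rcases ih with rfl | ih
    · rcases hac.1 with h0 | h0
      · left
        exact (mul_eq_zero.1 h0.symm).resolve_left (by linarith)
      · right
        exact .single ⟨.inl (by linarith), by nlinarith, by nlinarith⟩
    · exact .inr (ih.head hac)

theorem Reach.reach_of_exceptional {q z : ℝ} (hq : SmallBase q) (he : Exceptional q)
    (hc : (paths q (q ^ 2 - 1)).Countable) (h : Reach q (q ^ 2 - 1) z) (hz : z ≠ 0) :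
    Reach q z (q ^ 2 - 1) := by
  have hlo := hq.lo
  have hI : q ^ 2 - 1 ∈ Set.Icc 0 (q + 1) := ⟨by nlinarith, by nlinarith [hq.hi]⟩
  obtain ⟨w, hw, hs⟩ := exists_reach_single hq.one_lt (h.mem hI) (h.countable_paths hq.one_lt hc)
  obtain ⟨p, hp⟩ := Reach.exists_aeval (h.trans hw)
  rcases hs.eq_or_reach hq with rfl | rfl | hr
  · exact (hw.eq_zero_or_reach hq).resolve_left hz
  · refine absurd ?_ (he.sub_one_mul_aeval_ne (X * p))
    have : (q + 1) * ((q - 1) * aeval q p - 1) = 0 := by linear_combination -hp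
    have := (mul_eq_zero.1 this).resolve_left (by linarith)
    simp
    linear_combination q * this
  · obtain ⟨p, hp⟩ := Reach.exists_aeval ((h.trans hw).trans hr)
    refine absurd ?_ (he.sub_one_mul_aeval_ne ((X + 1) * p))
    simp
    linear_combination -hp

theorem Branch.sub_one_mul {q : ℝ} (hq : SmallBase q) : Branch q ((q - 1) * (q ^ 2 - 1)) := by
  have hlo := hq.lo
  have hhi := hq.hi
  have h1 : 0 ≤ (q ^ 2 - q - 1) * (q ^ 2 - 1) := mul_nonneg hq.pos.le (by nlinarith)
  have h2 : q * (q - 1) ^ 2 * (q + 1) ≤ 1 * (q + 1) :=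
    mul_le_mul_of_nonneg_right (by nlinarith) (by linarith)
  constructor <;> linarith

theorem SmallBase.step_one {q : ℝ} (hq : SmallBase q) :
    Step q (q ^ 2 - 1) ((q - 1) * (q ^ 2 - 1)) := by
  have hlo := hq.lo
  have hhi := hq.hi
  have h := Branch.sub_one_mul hq
  have h0 : 0 ≤ (q - 1) * (q ^ 2 - 1) := mul_nonneg (by linarith) (by nlinarith)
  exact ⟨.inr (by ring), h0, by nlinarith [h.2]⟩

/-- Between the golden ratio and the root of the quintic, the number `1` never has countably many
expansions. -/
theorem SmallBase.not_countable_paths_one {q : ℝ} (hq : SmallBase q) :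
    ¬ (paths q (q ^ 2 - 1)).Countable := by
  intro hc
  have hlo := hq.lo
  have hhi := hq.hi
  have hI : q ^ 2 - 1 ∈ Set.Icc 0 (q + 1) := ⟨by nlinarith, by nlinarith⟩
  have hb := Branch.sub_one_mul hq
  have hstep := hq.step_one
  have he := hq.exceptional_of_countable hI (fun hs => hs.2 _ (.single hstep) hb) hc
  refine not_countable_paths hq.one_lt (N := {y | Reach q (q ^ 2 - 1) y ∧ y ≠ 0})
    (fun y hy => Reach.mem hy.1 hI) (fun y hy => ?_) (y := q ^ 2 - 1)
    ⟨.refl, by nlinarith⟩ hc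
  have hr := (hy.1.reach_of_exceptional hq he hc hy.2).tail hstep
  refine ⟨_, hr, ⟨(hy.1.trans hr).tail (hb.step_left hq.one_lt), ?_⟩,
    ⟨(hy.1.trans hr).tail (hb.step_right hq.one_lt), ?_⟩⟩
  · have : 0 < q * ((q - 1) * (q ^ 2 - 1)) :=
      mul_pos (by linarith) (mul_pos (by linarith) (by nlinarith))
    exact this.ne'
  · have : 0 < (q ^ 2 - q - 1) * (q ^ 2 - 1) := mul_pos hq.pos (by nlinarith)
    intro h
    linarith

end Exceptional

/-! ### Countably many expansions -/

/-- Lazy digits: 0 whenever allowed. Otherwise q ≤ 2 makes the digit 1 admissible. -/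
theorem paths_nonempty {q z : ℝ} (hq : 1 < q) (hq2 : q ≤ 2) (hz : z ∈ Set.Icc 0 (q + 1)) :
    (paths q z).Nonempty := by
  classical
  let d : ℝ → Fin 2 := fun y => if q * y ≤ q + 1 then 0 else 1
  let T : ℝ → ℝ := fun y => q * y - ((d y : ℕ) : ℝ) * (q ^ 2 - 1)
  have hT : ∀ y ∈ Set.Icc 0 (q + 1), T y ∈ Set.Icc 0 (q + 1) := by
    rintro y ⟨h0, h1⟩
    by_cases h : q * y ≤ q + 1
    · have : T y = q * y := by simp [T, d, h]
      rw [this]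
      exact ⟨by positivity, h⟩
    · have : T y = q * y - (q ^ 2 - 1) := by simp [T, d, h]
      rw [this]
      constructor <;> nlinarith
  have horb : ∀ n, orbit q z (fun n => d (T^[n] z)) n = T^[n] z := by
    intro n
    induction n with
    | zero => rfl
    | succ n ih => rw [orbit, ih, Function.iterate_succ_apply']
  refine ⟨fun n => d (T^[n] z), fun n => ?_⟩
  rw [horb]
  induction n with
  | zero => exact hz
  | succ n ih => rw [Function.iterate_succ_apply']; exact hT _ ih

theorem step_orbit {q z : ℝ} {δ : ℕ → Fin 2} (h : δ ∈ paths q z) (n : ℕ) :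
    Step q (orbit q z δ n) (orbit q z δ (n + 1)) := by
  refine ⟨?_, h (n + 1)⟩
  have : δ n = 0 ∨ δ n = 1 := by omega
  rcases this with hd | hd
  · left; simp [orbit, hd]
  · right; simp [orbit, hd]

theorem reach_orbit {q z : ℝ} {δ : ℕ → Fin 2} (h : δ ∈ paths q z) (n : ℕ) :
    Reach q z (orbit q z δ n) := by
  induction n with
  | zero => exact .refl
  | succ n ih => exact ih.tail (step_orbit h n)

/-- If `q * y = v` at every branching `y` reachable from `z`, then at most one expansion of `z`
avoids `v`. -/
theorem subsingleton_of_avoids {q z v : ℝ} (hb : ∀ y, Reach q z y → Branch q y → q * y = v) :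
    {δ ∈ paths q z | ∀ n, orbit q z δ n ≠ v}.Subsingleton := by
  rintro δ ⟨hδ, hδv⟩ η ⟨hη, hηv⟩
  -- Where two expansions first differ there is a branching, and the one with digit 0 visits `v`.
  have key : ∀ n, orbit q z δ n = orbit q z η n → δ n = η n := by
    intro n h
    by_contra hne
    have h1 := hδ (n + 1)
    have h2 := hη (n + 1)
    have h1v := hδv (n + 1)
    have h2v := hηv (n + 1)
    rw [orbit] at h1 h1v h2 h2v
    rw [← h] at h2 h2v
    have hcases : δ n = 0 ∧ η n = 1 ∨ δ n = 1 ∧ η n = 0 := by omega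
    rcases hcases with ⟨a, b⟩ | ⟨a, b⟩ <;> simp only [a, b] at h1 h1v h2 h2v <;>
      simp at h1 h1v h2 h2v
    · exact h1v (hb _ (reach_orbit hδ n) ⟨by linarith, by linarith⟩)
    · exact h2v (hb _ (reach_orbit hδ n) ⟨by linarith, by linarith⟩)
  have horb : ∀ n, orbit q z δ n = orbit q z η n := by
    intro n
    induction n with
    | zero => rfl
    | succ n ih => rw [orbit, orbit, ih, key n ih]
  exact funext fun n => key n (horb n)

theorem Single.subsingleton_paths {q z : ℝ} (hz : Single q z) : (paths q z).Subsingleton := by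
  -- The value −1 lies outside [0, q + 1], so every expansion avoids it.
  refine (subsingleton_of_avoids (v := -1) fun y hy hb => absurd hb (hz.2 y hy)).anti
    fun δ hδ => ⟨hδ, fun n hn => ?_⟩
  have := (hδ n).1
  rw [hn] at this
  norm_num at this

/-- An expansion visiting v splits into a finite prefix and an expansion of v. -/
theorem countable_of_avoids {q z v : ℝ} (hb : ∀ y, Reach q z y → Branch q y → q * y = v)
    (hv : (paths q v).Countable) : (paths q z).Countable := by
  have hcover : paths q z ⊆ {δ ∈ paths q z | ∀ n, orbit q z δ n ≠ v} ∪
      ⋃ n, {δ ∈ paths q z | orbit q z δ n = v} := by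
    intro δ hδ
    by_cases h : ∀ n, orbit q z δ n ≠ v
    · exact .inl ⟨hδ, h⟩
    · push Not at h
      obtain ⟨n, hn⟩ := h
      exact .inr (Set.mem_iUnion.2 ⟨n, hδ, hn⟩)
  refine Set.Countable.mono hcover ((subsingleton_of_avoids hb).countable.union
    (Set.countable_iUnion fun n => ?_))
  let F : (ℕ → Fin 2) → (Fin n → Fin 2) × (ℕ → Fin 2) := fun δ => (fun i => δ i, fun i => δ (n + i))
  have hmaps : Set.MapsTo F {δ ∈ paths q z | orbit q z δ n = v} (Set.univ ×ˢ paths q v) := by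
    rintro δ ⟨hδ, rfl⟩
    refine ⟨trivial, fun m => ?_⟩
    change orbit q _ (fun i => δ (n + i)) m ∈ _
    rw [← orbit_add]
    exact hδ _
  refine hmaps.countable_of_injOn (fun δ _ η _ h => ?_) (Set.countable_univ.prod hv)
  obtain ⟨h1, h2⟩ := Prod.mk.inj h
  funext i
  by_cases hi : i < n
  · exact congrFun h1 ⟨i, hi⟩
  · have := congrFun h2 (i - n)
    rwa [Nat.add_sub_cancel' (not_lt.1 hi)] at this

/-! ### The root of the quintic -/

section Quintic

variable {q : ℝ}

/-- The points reachable from `q ^ 2 - 1` when `q` is the root of the quintic. -/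
def quinticOrbit (q : ℝ) : Set ℝ :=
  let w := (q ^ 2 - q - 1) * (q ^ 2 - 1)
  {q ^ 2 - 1, (q - 1) * (q ^ 2 - 1), w, q * w, q * (q * w), q * (q * (q * w)),
    q * ((q - 1) * (q ^ 2 - 1)), q, 1}

theorem quintic_bounds (h1 : 1.68 < q) (h2 : q < 1.681) :
    (1.82 < q ^ 2 - 1 ∧ q ^ 2 - 1 < 1.826) ∧
    (0.25 < (q ^ 2 - q - 1) * (q ^ 2 - 1) ∧ (q ^ 2 - q - 1) * (q ^ 2 - 1) < 0.265) := by
  have e1 : q ^ 2 < 2.826 := by nlinarith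
  have e2 : 2.822 < q ^ 2 := by nlinarith
  refine ⟨⟨by linarith, by linarith⟩, ?_, ?_⟩
  · have : (0.142 : ℝ) * 1.82 < (q ^ 2 - q - 1) * (q ^ 2 - 1) :=
      mul_lt_mul'' (by nlinarith) (by linarith) (by norm_num) (by norm_num)
    linarith
  · have : (q ^ 2 - q - 1) * (q ^ 2 - 1) < 0.145 * 1.826 :=
      mul_lt_mul'' (by nlinarith) (by linarith) (by nlinarith) (by linarith)
    linarith

theorem quinticOrbit_step (h1 : 1.68 < q) (h2 : q < 1.681)
    (h : q ^ 5 - q ^ 4 - q ^ 3 - q + 1 = 0) {y : ℝ} (hy : y ∈ quinticOrbit q) :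
    (Branch q y → q * y = q * ((q - 1) * (q ^ 2 - 1))) ∧
      ∀ y', Step q y y' → y' ∈ quinticOrbit q := by
  obtain ⟨⟨b1, b2⟩, b3, b4⟩ := quintic_bounds h1 h2
  set H := q ^ 2 - 1 with hH
  set s := (q - 1) * H with hs
  set w := (q ^ 2 - q - 1) * H with hw
  have k1 : q * H - H = s := by rw [hs]; ring
  -- The quintic closes the orbit twice: q³w equals s, the branching point, and in `k4` the other
  -- successor qs falls into the 2-cycle.
  have k2 : q * (q * (q * (q * w))) = q * s := by
    linear_combination (q * (q ^ 2 - 1)) * h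
  have k3 : q * s - H = w := by rw [hs, hw]; ring
  have k4 : q * (q * s) - H = q := by
    linear_combination h
  have k5 : q * q - H = 1 := by rw [hH]; ring
  have c1 : 0.42 < q * w := by nlinarith
  have c2 : q * w < 0.446 := by nlinarith
  have d1 : 0.7 < q * (q * w) := by nlinarith
  have d2 : q * (q * w) < 0.75 := by nlinarith
  have e1 : 1.17 < q * (q * (q * w)) := by nlinarith
  have e2 : q * (q * (q * w)) < 1.262 := by nlinarith
  have f1 : 3.3 < q * (q * s) := by linarith
  have g1 : 3 < q * H := by nlinarith
  simp only [quinticOrbit, Set.mem_insert_iff, Set.mem_singleton_iff, ← hH, ← hs, ← hw] at hy ⊢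
  simp only [Branch, Step, ← hH, Set.mem_Icc]
  refine ⟨fun hb => ?_, fun y' hy' => ?_⟩
  · obtain ⟨hb1, hb2⟩ := hb
    rcases hy with rfl | rfl | rfl | rfl | rfl | rfl | rfl | rfl | rfl <;> linarith
  · obtain ⟨hy1, hy2, hy3⟩ := hy'
    rcases hy with rfl | rfl | rfl | rfl | rfl | rfl | rfl | rfl | rfl
    · rcases hy1 with rfl | rfl
      · exfalso; linarith
      · exact .inr (.inl k1)
    · rcases hy1 with rfl | rfl
      · simp
      · right; right; left; exact k3
    · rcases hy1 with rfl | rfl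
      · simp
      · exfalso; linarith
    · rcases hy1 with rfl | rfl
      · simp
      · exfalso; linarith
    · rcases hy1 with rfl | rfl
      · simp
      · exfalso; linarith
    · rcases hy1 with rfl | rfl
      · simp [k2]
      · right; right; left; rw [k2]; exact k3
    · rcases hy1 with rfl | rfl
      · exfalso; linarith
      · simp [k4]
    · rcases hy1 with rfl | rfl
      · exfalso; linarith
      · simp [k5]
    · rcases hy1 with rfl | rfl
      · simp
      · exfalso; linarith

theorem quinticOrbit_of_reach (h1 : 1.68 < q) (h2 : q < 1.681)
    (h : q ^ 5 - q ^ 4 - q ^ 3 - q + 1 = 0) {y z : ℝ} (hr : Reach q y z)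
    (hy : y ∈ quinticOrbit q) : z ∈ quinticOrbit q := by
  induction hr with
  | refl => exact hy
  | tail _ hs ih => exact (quinticOrbit_step h1 h2 h ih).2 _ hs

theorem quintic_countable_paths (h1 : 1.68 < q) (h2 : q < 1.681)
    (h : q ^ 5 - q ^ 4 - q ^ 3 - q + 1 = 0) : (paths q (q ^ 2 - 1)).Countable := by
  have hb : ∀ x ∈ quinticOrbit q, ∀ y, Reach q x y → Branch q y →
      q * y = q * ((q - 1) * (q ^ 2 - 1)) := fun x hx y hy =>
    (quinticOrbit_step h1 h2 h (quinticOrbit_of_reach h1 h2 h hy hx)).1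
  refine countable_of_avoids (hb _ (by simp [quinticOrbit])) ?_
  obtain ⟨⟨b1, b2⟩, b3, b4⟩ := quintic_bounds h1 h2
  have k3 : q * ((q - 1) * (q ^ 2 - 1)) = (q ^ 2 - q - 1) * (q ^ 2 - 1) + (q ^ 2 - 1) := by ring
  have k4 : q * (q * ((q - 1) * (q ^ 2 - 1))) - (q ^ 2 - 1) = q := by linear_combination h
  refine Set.Subsingleton.countable (Single.subsingleton_paths ⟨⟨by linarith, by linarith⟩,
    fun y hy => ?_⟩)
  have hy' : y = q * ((q - 1) * (q ^ 2 - 1)) ∨ y = q ∨ y = 1 := by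
    induction hy with
    | refl => exact .inl rfl
    | @tail a b _ hs ih =>
      obtain ⟨hs, hs0, hs1⟩ := hs
      rcases ih with rfl | rfl | rfl <;> rcases hs with rfl | rfl
      · linarith
      · exact .inr (.inl k4)
      · linarith
      · exact .inr (.inr (by ring))
      · exact .inr (.inl (mul_one q))
      · linarith
  rintro ⟨hb1, hb2⟩
  rcases hy' with rfl | rfl | rfl <;> linarith

/-- Prefixing 0001 maps the expansions of w injectively into themselves, but misses those that leave
the loop with 0000. -/
theorem quintic_infinite_paths (h1 : 1.68 < q) (h2 : q < 1.681)
    (h : q ^ 5 - q ^ 4 - q ^ 3 - q + 1 = 0) : ¬ (paths q (q ^ 2 - 1)).Finite := by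
  intro hfin
  obtain ⟨⟨b1, b2⟩, b3, b4⟩ := quintic_bounds h1 h2
  have hq : 1 < q := by linarith
  have k2 : q * (q * (q * (q * ((q ^ 2 - q - 1) * (q ^ 2 - 1))))) =
      q * ((q - 1) * (q ^ 2 - 1)) := by
    linear_combination (q * (q ^ 2 - 1)) * h
  set w := (q ^ 2 - q - 1) * (q ^ 2 - 1) with hw
  have s1 : Step q (q ^ 2 - 1) ((q - 1) * (q ^ 2 - 1)) :=
    ⟨.inr (by ring), by nlinarith, by nlinarith⟩
  have s2 : Step q ((q - 1) * (q ^ 2 - 1)) w := ⟨.inr (by linarith), by linarith, by linarith⟩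
  have hfw := Reach.finite_paths hq ((Relation.ReflTransGen.single s1).tail s2) hfin
  have hloop : Set.MapsTo (consDigit 0 ∘ consDigit 0 ∘ consDigit 0 ∘ consDigit 1) (paths q w)
      (paths q w) := by
    intro δ hδ
    refine consDigit_mem_paths hq (consDigit_mem_paths hq (consDigit_mem_paths hq
      (consDigit_mem_paths hq ?_)))
    convert hδ using 2
    simp only [Fin.val_zero, Fin.val_one, Nat.cast_zero, Nat.cast_one, zero_mul, sub_zero, one_mul]
    rw [k2]
    linarith
  have hexit : ∃ δ ∈ paths q w, δ 3 = 0 := by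
    obtain ⟨τ, hτ⟩ := paths_nonempty hq (by linarith) (z := q * ((q - 1) * (q ^ 2 - 1)))
      ⟨by nlinarith, by nlinarith⟩
    refine ⟨consDigit 0 (consDigit 0 (consDigit 0 (consDigit 0 τ))),
      consDigit_mem_paths hq (consDigit_mem_paths hq (consDigit_mem_paths hq
      (consDigit_mem_paths hq ?_))), rfl⟩
    convert hτ using 2
    simp only [Fin.val_zero, Nat.cast_zero, zero_mul, sub_zero]
    rw [k2]
  have hinj : Function.Injective (consDigit 0 ∘ consDigit 0 ∘ consDigit 0 ∘ consDigit 1) :=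
    (consDigit_injective 0).comp ((consDigit_injective 0).comp
      ((consDigit_injective 0).comp (consDigit_injective 1)))
  obtain ⟨δ, hδ, hδ3⟩ := hexit
  have : Finite (paths q w) := hfw
  obtain ⟨η, hη⟩ := Finite.surjective_of_injective
    ((hloop.restrict_inj).2 hinj.injOn) ⟨δ, hδ⟩
  have h3 : (1 : Fin 2) = δ 3 := congrFun (congrArg Subtype.val hη) 3
  exact absurd (h3.trans hδ3) (by decide)

end Quintic

/-! ### The main theorem -/

/-- At 1 + t the quintic divided by t is t⁴ + 4t³ + 5t² + t − 3 − 1/t, which increases; `key` is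
this without denominators. -/
theorem quintic_neg_of_lt {x y : ℝ} (hx : 1 < x) (hxy : x < y)
    (hy : y ^ 5 - y ^ 4 - y ^ 3 - y + 1 ≤ 0) : x ^ 5 - x ^ 4 - x ^ 3 - x + 1 < 0 := by
  obtain ⟨t, rfl⟩ : ∃ t, x = 1 + t := ⟨x - 1, by ring⟩
  obtain ⟨s, rfl⟩ : ∃ s, y = 1 + s := ⟨y - 1, by ring⟩
  have ht : 0 < t := by linarith
  have hts : t < s := by linarith
  have e4 : t ^ 4 < s ^ 4 := by gcongr
  have e3 : t ^ 3 < s ^ 3 := by gcongr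
  have e2 : t ^ 2 < s ^ 2 := by gcongr
  have key : s * ((1 + t) ^ 5 - (1 + t) ^ 4 - (1 + t) ^ 3 - (1 + t) + 1) =
      t * ((1 + s) ^ 5 - (1 + s) ^ 4 - (1 + s) ^ 3 - (1 + s) + 1) -
      (s * t * ((s ^ 4 - t ^ 4) + 4 * (s ^ 3 - t ^ 3) + 5 * (s ^ 2 - t ^ 2) + (s - t)) + (s - t)) :=
    by ring
  have h1 : 0 < s * t * ((s ^ 4 - t ^ 4) + 4 * (s ^ 3 - t ^ 3) + 5 * (s ^ 2 - t ^ 2) + (s - t)) :=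
    mul_pos (mul_pos (by linarith) ht) (by linarith)
  have h2 := mul_nonpos_of_nonneg_of_nonpos ht.le hy
  by_contra hc
  have h3 := mul_nonneg (ht.trans hts).le (not_lt.1 hc)
  linarith

theorem quintic_root_unique {x y : ℝ} (hx : 1 < x) (hy : 1 < y)
    (hfx : x ^ 5 - x ^ 4 - x ^ 3 - x + 1 = 0) (hfy : y ^ 5 - y ^ 4 - y ^ 3 - y + 1 = 0) :
    x = y := by
  rcases lt_trichotomy x y with h | h | h
  · exact absurd hfx (quintic_neg_of_lt hx h hfy.le).ne
  · exact h
  · exact absurd hfy (quintic_neg_of_lt hy h hfx.le).ne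

theorem exists_quintic_root : ∃ x : ℝ, 1.680415 < x ∧ x < 1.680425 ∧
    x ^ 5 - x ^ 4 - x ^ 3 - x + 1 = 0 := by
  have hcont : ContinuousOn (fun x : ℝ => x ^ 5 - x ^ 4 - x ^ 3 - x + 1)
      (Set.Icc 1.680415 1.680425) := by fun_prop
  obtain ⟨x, hx, h0⟩ := intermediate_value_Ioo (by norm_num) hcont
    (show (0 : ℝ) ∈ Set.Ioo _ _ by constructor <;> norm_num)
  exact ⟨x, hx.1, hx.2, h0⟩

theorem theorem1 :
    ∃ q₃ : ℝ,
      -- `q₃` is the root of the quintic that is greater than `1`, and `q₃ ≈ 1.68042`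
      (1 < q₃ ∧ q₃ ^ 5 - q₃ ^ 4 - q₃ ^ 3 - q₃ + 1 = 0) ∧
      (∀ x : ℝ, 1 < x → x ^ 5 - x ^ 4 - x ^ 3 - x + 1 = 0 → x = q₃) ∧
      |q₃ - 1.68042| < 0.000005 ∧
      -- `q₃` is the least element of `𝓑_{1,ℵ₀}` above the golden ratio
      IsLeast {q : ℝ | q ∈ basesOfOne Cardinal.aleph0 ∧ (1 + Real.sqrt 5) / 2 < q} q₃ := by
  obtain ⟨x, hlo, hhi, h0⟩ := exists_quintic_root
  have h1 : 1 < x := by linarith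
  have hs : Real.sqrt 5 < 2.3 := by
    rw [Real.sqrt_lt' (by norm_num)]
    norm_num
  have hs1 : 2.2 < Real.sqrt 5 := Real.lt_sqrt_of_sq_lt (by norm_num)
  have hs2 : Real.sqrt 5 ^ 2 = 5 := Real.sq_sqrt (by norm_num)
  refine ⟨x, ⟨h1, h0⟩, fun y hy hfy => quintic_root_unique hy h1 hfy h0, ?_,
    ⟨⟨⟨⟨by linarith, by linarith⟩, ?_⟩, by linarith⟩, ?_⟩⟩
  · rw [abs_lt]
    constructor <;> linarith
  · have e := expansions_eq_paths h1 1
    rw [mul_one] at e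
    rw [e]
    have hinf : (paths x (x ^ 2 - 1)).Infinite :=
      quintic_infinite_paths (by linarith) (by linarith) h0
    have : Infinite (paths x (x ^ 2 - 1)) := hinf.to_subtype
    have : Countable (paths x (x ^ 2 - 1)) :=
      (quintic_countable_paths (by linarith) (by linarith) h0).to_subtype
    exact Cardinal.mk_eq_aleph0 _
  · rintro q ⟨⟨-, hcard⟩, hq⟩
    by_contra hlt
    push Not at hlt
    have hq1 : 1 < q := by linarith
    have hsmall : SmallBase q := ⟨hq1, by nlinarith, quintic_neg_of_lt hq1 hlt h0.le⟩
    refine hsmall.not_countable_paths_one ?_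
    have e := expansions_eq_paths hq1 1
    rw [mul_one] at e
    rw [e] at hcard
    exact Cardinal.le_aleph0_iff_set_countable.1 hcard.le
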